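/- Consider quantum circuits with intermediate measurements and feedback, defined as follows. A circuit is a finite sequence of layers. Each layer is either a set of gates acting on pairwise disjoint sets of qubits, every gate being an arbitrary one-qubit unitary or a CNOT, or a simultaneous measurement of a set of qubits in the computational basis. The layout of the circuit is fixed, but each gate may be conditioned on an arbitrary Boolean function of the outcomes of earlier measurements (classical computation is free). The depth is the number of layers. The size is the total number of gates and single-qubit measurements. There are constants $D, K$ such that for every $n$ and every $n$-qubit state $|\psi\rangle$ (a unit vector of $(\mathbb{C}^2)^{\otimes n}$) there are a number of ancillas $m \le K\, n 2^n$ and such a circuit on $n+m$ qubits, of depth at most $D$, of size at most $K\, n 2^n$ and with at most $81$ measurement layers, which prepares $|\psi\rangle$ from $|0\rangle^{\otimes n}$: started in $|0\rangle^{\otimes n}\otimes|0\rangle^{\otimes m}$ it ends, for every sequence of measurement outcomes of positive probability, in the state $|\psi\rangle\otimes|0\rangle^{\otimes m}$ up to a global phase. -/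

import Mathlib

/-- A (not necessarily normalised) pure state of the qubits labelled by `ι`, given by its
amplitudes in the computational basis `|x⟩`, `x : ι → {0,1}`. -/
abbrev QState (ι : Type) : Type := (ι → Fin 2) → ℂ

/-- The elementary gates: an arbitrary unitary on one qubit, and the CNOT gate with control `c`
and target `t`. -/
inductive QGate (ι : Type) : Type
  | single (i : ι) (U : Matrix.unitaryGroup (Fin 2) ℂ) : QGate ι
  | cnot (c t : ι) (h : c ≠ t) : QGate ι

/-- The qubits that a gate acts on. -/
def QGate.support {ι : Type} [DecidableEq ι] : QGate ι → Finset ι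
  | .single i _ => {i}
  | .cnot c t _ => {c, t}

/-- The unitary action of a gate. The one-qubit gate `U` on qubit `i` sends `|b⟩ᵢ` to
`∑ a, U a b |a⟩ᵢ`; the CNOT gate sends `|x_c, x_t⟩` to `|x_c, x_t ⊕ x_c⟩` (addition in `Fin 2` is
the exclusive or, and the map on bit strings is an involution). -/
def QGate.apply {ι : Type} [DecidableEq ι] : QGate ι → QState ι → QState ι
  | .single i U, v => fun x => ∑ b : Fin 2, U.1 (x i) b * v (Function.update x i b)
  | .cnot c t _, v => fun x => v (Function.update x t (x t + x c))

/-- The classical record of the measurement layers performed so far, oldest first. An entry is the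
outcome of one layer, as a function of the measured qubit; qubits that the layer does not measure
are recorded as `0`. -/
abbrev MeasRecord (ι : Type) : Type := List (ι → Fin 2)

/-- A gate with feedback: it is applied if and only if the Boolean function `cond` of the
earlier measurement outcomes is true. -/
structure FeedbackGate (ι : Type) : Type where
  gate : QGate ι
  cond : MeasRecord ι → Bool

/-- A layer of a circuit: gates on pairwise disjoint sets of qubits, which are executed in parallel,
or the measurement of a set of qubits in the computational basis. -/
inductive QLayer (ι : Type) [DecidableEq ι] : Type
  | gates (gs : List (FeedbackGate ι))
      (h : gs.Pairwise fun a b => Disjoint a.gate.support b.gate.support) : QLayer ι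
  | measure (S : Finset ι) : QLayer ι

/-- A quantum circuit with intermediate measurements and feedback on the qubits `ι`. -/
abbrev MFCircuit (ι : Type) [DecidableEq ι] : Type := List (QLayer ι)

namespace MFCircuit

variable {ι : Type} [DecidableEq ι]

/-- The (unnormalised) state after the qubits in `S` were measured with outcome `o`. Its squared
norm is that of `v` times the probability of the outcome. -/
def collapse (S : Finset ι) (o : ι → Fin 2) (v : QState ι) : QState ι :=
  fun x => if ∀ i ∈ S, x i = o i then v x else 0

/-- The outcome `o` restricted to the measured qubits `S`. -/
def restrictOutcome (S : Finset ι) (o : ι → Fin 2) : ι → Fin 2 :=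
  fun i => if i ∈ S then o i else 0

/-- Apply a gate with feedback, given the record of the earlier outcomes. -/
def applyGate (rec : MeasRecord ι) (v : QState ι) (g : FeedbackGate ι) : QState ι :=
  if g.cond rec then g.gate.apply v else v

/-- The branch of the execution in which the `k`-th measurement layer (counted from `0`) yields the
outcome `r k i` on each qubit `i` that it measures, started in the state `v` with earlier record
`rec`: the unnormalised final state. For a unit vector `v` and `rec = []`, its squared norm
is the probability of the branch. -/
def branch (r : ℕ → ι → Fin 2) : MFCircuit ι → MeasRecord ι → QState ι → QState ι
  | [], _, v => v
  | .gates gs _ :: C, rec, v => branch r C rec (gs.foldl (applyGate rec) v)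
  | .measure S :: C, rec, v =>
      branch r C (rec ++ [restrictOutcome S (r rec.length)]) (collapse S (r rec.length) v)

/-- The number of layers, gate layers and measurement layers alike. -/
def depth (C : MFCircuit ι) : ℕ := List.length C

/-- The number of operations in a layer: its gates, or its single-qubit measurements. -/
def layerSize : QLayer ι → ℕ
  | .gates gs _ => gs.length
  | .measure S => S.card

/-- The size: the total number of gates and single-qubit measurements. A gate with feedback is
counted whether or not it is applied. -/
def size (C : MFCircuit ι) : ℕ := (C.map layerSize).sum

/-- Whether a layer is a measurement layer. -/
def isMeasurement : QLayer ι → Bool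
  | .gates _ _ => false
  | .measure _ => true

/-- The number of measurement layers. -/
def measLayers (C : MFCircuit ι) : ℕ := C.countP isMeasurement

/-- The computational basis state `|0…0⟩`. -/
def zeroState [Fintype ι] : QState ι := fun x => if ∀ i, x i = 0 then 1 else 0

/-- The state `ψ ⊗ |0…0⟩` of `n` qubits and `m` ancillas. -/
def withAncillas {n m : ℕ} (ψ : EuclideanSpace ℂ (Fin n → Fin 2)) : QState (Fin n ⊕ Fin m) :=
  fun x => if ∀ j : Fin m, x (Sum.inr j) = 0 then ψ (fun i => x (Sum.inl i)) else 0

/-- The circuit prepares `ψ` from `|0⟩^{⊗n}`, with `m` ancillas that start and end in `|0⟩`: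
whatever the measurement outcomes, the final state is `ψ ⊗ |0⟩^{⊗m}`, up to the normalisation of
the branch and a global phase. (Branches of probability `0` have the zero vector as
final state; the probabilities of the branches add up to `1`.) -/
def Prepares {n m : ℕ} (C : MFCircuit (Fin n ⊕ Fin m))
    (ψ : EuclideanSpace ℂ (Fin n → Fin 2)) : Prop :=
  ∀ r : ℕ → Fin n ⊕ Fin m → Fin 2, ∃ c : ℂ, branch r C [] zeroState = c • withAncillas ψ

end MFCircuit

/-! Measurements parallelise long chains of parities. Put ancillas `z` in uniform superposition and
measure sparse parity checks of the register bits `x` and `z`. The checks form a triangular linear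
system over the two-element field, so an outcome pins `z` to the wanted bits `sol x` up to a shift
that depends on the outcome only; `X` gates remove it. After phase gates on `z`, measuring `z` in
the Hadamard basis leaves a sign that is a character of `x`, removed by `Z` gates. Hence any product
of `N` phases of running parities is applied in depth 11 with `4 * N` ancillas
(`ParityChecks.branch_circuit`, `sim_diag`). The indicator of an AND of `m` literals expands into `2
^ m` parities, so a phase controlled by it costs `2 ^ m * m` (`hasPhase_and`); between Hadamard
gates, sign phases become controlled bit flips (`conjDiag_hadamard`).

To prepare `ψ`, factor the moduli `‖ψ x‖` into conditional amplitudes along the path to the leaf `x`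
of a binary tree (`exists_angles`), and put a qubit with these amplitudes at every inner node.
Following the bits from the root leads to the leaf `x` with the right amplitude, but the node qubits
stay entangled with it. So indicators of the reached nodes are computed, the leaf is written to the
output (`write_out`), the indicators are uncomputed, and they are recomputed from the output alone.
Now every node can be reset (`reset_nodes`): on the path its bit is a known bit of `x` and is
flipped to 0; off the path it is still in its original one-qubit state, which a fixed reflection
sends to `|0⟩`. The phases of `ψ` are put on the leaves, and the indicators are uncomputed again.

The cost lies in the path indicators, since an AND of up to `n` literals is too expensive. For nodes
of depth at most `e = n - k`, where `2 ^ k` is about `√n`, mismatches are counted in about `log n`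
qubits, all of which are 0 exactly when there is no mismatch (`counters_eq_zero_iff`); the AND over
these qubits costs about `n log n`. A deeper node adds at most `k` literals to the indicator of its
ancestor. Altogether `O(n 2 ^ n)` qubits suffice, and the size is at most the depth times the number
of qubits (`size_le`). -/

namespace MFCircuit

/-! ### Linearity of branches, size bounds, layers of local gates and of CNOTs. -/

section Basics

lemma collapse_smul {ι : Type} (S : Finset ι) (o : ι → Fin 2) (c : ℂ) (v : QState ι) :
    collapse S o (c • v) = c • collapse S o v := by
  funext x
  simp only [collapse, Pi.smul_apply, smul_eq_mul]
  split_ifs <;> simp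

variable {ι : Type} [DecidableEq ι]

lemma gate_apply_smul (g : QGate ι) (c : ℂ) (v : QState ι) :
    g.apply (c • v) = c • g.apply v := by
  cases g with
  | single i U =>
    funext x
    simp only [QGate.apply, Pi.smul_apply, smul_eq_mul, Finset.mul_sum]
    exact Finset.sum_congr rfl fun b _ => by ring
  | cnot c' t h => rfl

lemma applyGate_smul (rec : MeasRecord ι) (g : FeedbackGate ι) (c : ℂ) (v : QState ι) :
    applyGate rec (c • v) g = c • applyGate rec v g := by
  unfold applyGate
  split_ifs
  · exact gate_apply_smul _ _ _
  · rfl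

lemma foldl_applyGate_smul (rec : MeasRecord ι) (gs : List (FeedbackGate ι)) (c : ℂ)
    (v : QState ι) :
    gs.foldl (applyGate rec) (c • v) = c • gs.foldl (applyGate rec) v := by
  induction gs generalizing v with
  | nil => rfl
  | cons g gs ih => simp only [List.foldl_cons, applyGate_smul, ih]

lemma branch_smul (r : ℕ → ι → Fin 2) (C : MFCircuit ι) (rec : MeasRecord ι) (c : ℂ)
    (v : QState ι) : branch r C rec (c • v) = c • branch r C rec v := by
  induction C generalizing rec v with
  | nil => rfl
  | cons l C ih =>
    cases l with
    | gates gs h => simp only [branch, foldl_applyGate_smul, ih]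
    | measure S => simp only [branch, collapse_smul, ih]

/-- The record reached after `C₁` depends on the outcomes `r` but not on the state, hence the order
of the quantifiers. -/
lemma exists_branch_append (r : ℕ → ι → Fin 2) (C₁ C₂ : MFCircuit ι) (rec : MeasRecord ι) :
    ∃ rec', ∀ v, branch r (C₁ ++ C₂) rec v = branch r C₂ rec' (branch r C₁ rec v) := by
  induction C₁ generalizing rec with
  | nil => exact ⟨rec, fun v => rfl⟩
  | cons l C ih =>
    cases l with
    | gates gs h =>
      obtain ⟨rec', h'⟩ := ih rec
      exact ⟨rec', fun v => h' _⟩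
    | measure S =>
      obtain ⟨rec', h'⟩ := ih (rec ++ [restrictOutcome S (r rec.length)])
      exact ⟨rec', fun v => h' _⟩

lemma gate_support_nonempty (g : QGate ι) : g.support.Nonempty := by
  cases g <;> simp [QGate.support]

/-- Gates of a layer have disjoint nonempty supports, so picking a qubit from each support is
injective. -/
lemma layerSize_le [Fintype ι] (l : QLayer ι) : layerSize l ≤ Fintype.card ι := by
  cases l with
  | measure S => exact Finset.card_le_univ S
  | gates gs h =>
    choose f hf using fun g : FeedbackGate ι => gate_support_nonempty g.gate
    have hn : (gs.map f).Nodup := by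
      rw [List.Nodup, List.pairwise_map]
      refine h.imp fun {a b} hab e => ?_
      exact Finset.disjoint_left.1 hab (hf a) (e ▸ hf b)
    have := List.Nodup.length_le_card hn
    simpa [layerSize] using this

lemma size_le [Fintype ι] (C : MFCircuit ι) : size C ≤ depth C * Fintype.card ι := by
  induction C with
  | nil => simp [size]
  | cons l C ih =>
    simp only [size, depth, List.map_cons, List.sum_cons, List.length_cons] at *
    have := layerSize_le l
    rw [add_mul, one_mul]
    omega

lemma measLayers_append (C₁ C₂ : MFCircuit ι) :
    measLayers (C₁ ++ C₂) = measLayers C₁ + measLayers C₂ := List.countP_append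

/-- The one-qubit unitaries `U j` applied to the qubits `q j`, for `j` in a list. -/
def locL {J : Type} (l : List J) (q : J → ι) (U : J → Matrix.unitaryGroup (Fin 2) ℂ)
    (v : QState ι) : QState ι :=
  l.foldl (fun v j => (QGate.single (q j) (U j)).apply v) v

@[simp] lemma locL_nil {J : Type} (q : J → ι) (U : J → Matrix.unitaryGroup (Fin 2) ℂ)
    (v : QState ι) : locL [] q U v = v := rfl

@[simp] lemma locL_cons {J : Type} (j : J) (l : List J) (q : J → ι)
    (U : J → Matrix.unitaryGroup (Fin 2) ℂ) (v : QState ι) :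
    locL (j :: l) q U v = locL l q U ((QGate.single (q j) (U j)).apply v) := rfl

lemma single_apply_single_inv (i : ι) (U V : Matrix.unitaryGroup (Fin 2) ℂ) (h : V * U = 1)
    (v : QState ι) : (QGate.single i V).apply ((QGate.single i U).apply v) = v := by
  funext x
  have hm : ∀ a c, ∑ b, V.1 a b * U.1 b c = if a = c then 1 else 0 := by
    intro a c
    have := congrArg (fun W : Matrix.unitaryGroup (Fin 2) ℂ => W.1 a c) h
    simpa [Matrix.mul_apply, Matrix.one_apply] using this
  simp only [QGate.apply, Function.update_self, Function.update_idem, Finset.mul_sum]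
  rw [Finset.sum_comm]
  have : ∀ c, ∑ b, V.1 (x i) b * (U.1 b c * v (Function.update x i c)) =
      (if x i = c then 1 else 0) * v (Function.update x i c) := by
    intro c
    rw [← hm, Finset.sum_mul]
    exact Finset.sum_congr rfl fun b _ => by ring
  simp [this]

lemma single_apply_one (i : ι) (v : QState ι) : (QGate.single i 1).apply v = v := by
  funext x
  simp [QGate.apply, Matrix.one_apply]

lemma locL_append {J : Type} (l₁ l₂ : List J) (q : J → ι)
    (U : J → Matrix.unitaryGroup (Fin 2) ℂ) (v : QState ι) :
    locL (l₁ ++ l₂) q U v = locL l₂ q U (locL l₁ q U v) := List.foldl_append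

lemma locL_reverse_inv {J : Type} (l : List J) (q : J → ι)
    (U : J → Matrix.unitaryGroup (Fin 2) ℂ) (v : QState ι) :
    locL l.reverse q (fun j => (U j)⁻¹) (locL l q U v) = v := by
  induction l generalizing v with
  | nil => rfl
  | cons j l ih =>
    rw [locL_cons, List.reverse_cons, locL_append, ih, locL_cons, locL_nil,
      single_apply_single_inv _ _ _ (inv_mul_cancel _)]

/-- Local unitaries act factorwise on states that are a product over the qubits acted on, with
coefficients that may depend on the other qubits. -/
lemma locL_prod {J : Type} [Fintype J] [DecidableEq J] (l : List J) (hl : l.Nodup) (q : J → ι)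
    (hq : Function.Injective q) (U : J → Matrix.unitaryGroup (Fin 2) ℂ) (K : (ι → Fin 2) → ℂ)
    (g : J → (ι → Fin 2) → Fin 2 → ℂ) (hK : ∀ x j c, K (Function.update x (q j) c) = K x)
    (hg : ∀ i x j c, g i (Function.update x (q j) c) = g i x) :
    locL l q U (fun x => K x * ∏ j, g j x (x (q j))) =
      fun x => K x * ∏ j, if j ∈ l then ∑ b, (U j).1 (x (q j)) b * g j x b
        else g j x (x (q j)) := by
  induction l generalizing g with
  | nil => simp
  | cons j l ih =>
    have hj : j ∉ l := (List.nodup_cons.1 hl).1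
    set g' : J → (ι → Fin 2) → Fin 2 → ℂ :=
      fun i x a => if i = j then ∑ b, (U j).1 a b * g j x b else g i x a with hg'
    have key : (QGate.single (q j) (U j)).apply (fun x => K x * ∏ j, g j x (x (q j))) =
        fun x => K x * ∏ i, g' i x (x (q i)) := by
      funext x
      simp only [QGate.apply, hK, hg]
      rw [← Finset.mul_prod_erase _ _ (Finset.mem_univ j)]
      have h1 : ∀ b, ∏ i, g i x (Function.update x (q j) b (q i)) =
          g j x b * ∏ i ∈ Finset.univ.erase j, g' i x (x (q i)) := by
        intro b
        rw [← Finset.mul_prod_erase _ _ (Finset.mem_univ j)]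
        congr 1
        · simp
        · refine Finset.prod_congr rfl fun i hi => ?_
          have hij : i ≠ j := Finset.ne_of_mem_erase hi
          rw [Function.update_of_ne (hq.ne hij)]
          simp [hg', hij]
      simp only [h1]
      simp only [hg', if_true]
      rw [Finset.sum_mul, Finset.mul_sum]
      exact Finset.sum_congr rfl fun b _ => by ring
    rw [locL_cons, key, ih (List.nodup_cons.1 hl).2]
    · funext x
      congr 1
      refine Finset.prod_congr rfl fun i _ => ?_
      by_cases hij : i = j
      · subst hij; simp [hj, hg']
      · simp [hij, hg']
    · intro i x k c
      funext a
      simp only [hg', hg]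

lemma locL_univ_prod {J : Type} [Fintype J] [DecidableEq J] (q : J → ι)
    (hq : Function.Injective q) (U : J → Matrix.unitaryGroup (Fin 2) ℂ) (K : (ι → Fin 2) → ℂ)
    (g : J → (ι → Fin 2) → Fin 2 → ℂ) (hK : ∀ x j c, K (Function.update x (q j) c) = K x)
    (hg : ∀ i x j c, g i (Function.update x (q j) c) = g i x) :
    locL Finset.univ.toList q U (fun x => K x * ∏ j, g j x (x (q j))) =
      fun x => K x * ∏ j, ∑ b, (U j).1 (x (q j)) b * g j x b := by
  rw [locL_prod _ (Finset.nodup_toList _) q hq U K g hK hg]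
  simp

/-- The layer of the one-qubit gates `U j` on the qubits `q j`, with feedback. -/
def localLayer {J : Type} (l : List J) (hl : l.Nodup) (q : J → ι) (hq : Function.Injective q)
    (U : J → Matrix.unitaryGroup (Fin 2) ℂ) (cond : J → MeasRecord ι → Bool) : QLayer ι :=
  .gates (l.map fun j => ⟨.single (q j) (U j), cond j⟩) (by
    rw [List.pairwise_map]
    refine hl.imp fun {a b} hab => ?_
    simpa [QGate.support] using fun h => hab (hq h))

lemma branch_localLayer {J : Type} (l : List J) (hl : l.Nodup) (q : J → ι)
    (hq : Function.Injective q) (U : J → Matrix.unitaryGroup (Fin 2) ℂ)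
    (cond : J → MeasRecord ι → Bool) (r : ℕ → ι → Fin 2) (C : MFCircuit ι)
    (rec : MeasRecord ι) (v : QState ι) :
    branch r (localLayer l hl q hq U cond :: C) rec v =
      branch r C rec (locL l q (fun j => if cond j rec then U j else 1) v) := by
  rw [localLayer, branch]
  congr 1
  clear hl
  induction l generalizing v with
  | nil => rfl
  | cons j l ih =>
    rw [List.map_cons, List.foldl_cons, ih, locL_cons]
    congr 1
    unfold applyGate
    simp only
    split_ifs
    · rfl
    · exact (single_apply_one _ _).symm

/-- A layer of CNOT gates: the qubit `j` of the second register is the target of a gate controlled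
by the qubit `c j` of the first register, if there is one. -/
noncomputable def cnotLayer {W J : Type} [DecidableEq W] [DecidableEq J] [Fintype J]
    (c : J → Option W)
    (hc : ∀ i j a, c i = some a → c j = some a → i = j) : QLayer (W ⊕ J) :=
  .gates (Finset.univ.toList.filterMap fun j => (c j).map fun a =>
      (⟨.cnot (.inl a) (.inr j) Sum.inl_ne_inr, fun _ => true⟩ : FeedbackGate (W ⊕ J))) (by
    rw [List.pairwise_filterMap]
    refine (Finset.nodup_toList _).imp fun {i j} hij g hg g' hg' => ?_
    obtain ⟨a, ha, rfl⟩ := Option.map_eq_some_iff.1 hg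
    obtain ⟨b, hb, rfl⟩ := Option.map_eq_some_iff.1 hg'
    have hab : a ≠ b := fun e => hij (hc i j a ha (e ▸ hb))
    simp [QGate.support, hab.symm, hij.symm])

/-- Controls lie in the first register and targets in the second, so no gate disturbs the control of
another and all of them act at once. -/
lemma branch_cnotLayer {W J : Type} [DecidableEq W] [DecidableEq J] [Fintype J]
    (c : J → Option W) (hc : ∀ i j a, c i = some a → c j = some a → i = j)
    (r : ℕ → W ⊕ J → Fin 2) (C : MFCircuit (W ⊕ J)) (rec : MeasRecord (W ⊕ J))
    (v : QState (W ⊕ J)) :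
    branch r (cnotLayer c hc :: C) rec v = branch r C rec (fun x => v (Sum.elim (x ∘ Sum.inl)
      fun j => x (.inr j) + (c j).elim 0 fun a => x (.inl a))) := by
  have key : ∀ (l : List J), l.Nodup → ∀ v : QState (W ⊕ J),
      (l.filterMap fun j => (c j).map fun a =>
        (⟨.cnot (.inl a) (.inr j) Sum.inl_ne_inr, fun _ => true⟩ :
          FeedbackGate (W ⊕ J))).foldl (applyGate rec) v =
      fun x => v (Sum.elim (x ∘ Sum.inl)
        fun j => x (.inr j) + if j ∈ l then (c j).elim 0 fun a => x (.inl a) else 0) := by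
    intro l hl
    induction l with
    | nil =>
      intro v
      funext x
      simp only [List.filterMap_nil, List.foldl_nil, List.not_mem_nil, if_false, add_zero]
      congr 1
      funext k
      cases k <;> rfl
    | cons j l ih =>
      intro v
      have hj := (List.nodup_cons.1 hl).1
      have ih := ih (List.nodup_cons.1 hl).2
      rw [List.filterMap_cons]
      cases h : c j with
      | none =>
        simp only [Option.map_none]
        rw [ih]
        funext x
        congr 2
        funext k
        by_cases hk : k = j
        · subst hk; simp [h]
        · simp [hk]
      | some a =>
        simp only [Option.map_some, List.foldl_cons]
        rw [ih]
        funext x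
        simp only [applyGate, if_true, QGate.apply]
        congr 1
        funext k
        rcases k with k | k
        · simp
        · by_cases hk : k = j
          · subst hk; simp [h, hj]
          · simp [hk]
  rw [cnotLayer, branch, key _ (Finset.nodup_toList _)]
  simp

end Basics

end MFCircuit

namespace MFCircuit

/-! ### Signs and one-qubit gates. -/

section OneQubit

/-- The sign `(-1) ^ (a * b)`. -/
def bsign (a b : Fin 2) : ℂ := if a = 1 ∧ b = 1 then -1 else 1

lemma bsign_add_right (a b c : Fin 2) : bsign a (b + c) = bsign a b * bsign a c := by
  fin_cases a <;> fin_cases b <;> fin_cases c <;> simp [bsign]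

@[simp] lemma bsign_zero_right (a : Fin 2) : bsign a 0 = 1 := by simp [bsign]

@[simp] lemma bsign_zero_left (a : Fin 2) : bsign 0 a = 1 := by simp [bsign]

@[simp] lemma bsign_mul_self (a b : Fin 2) : bsign a b * bsign a b = 1 := by
  fin_cases a <;> fin_cases b <;> simp [bsign]

lemma bsign_sum_right {J : Type*} (s : Finset J) (a : Fin 2) (f : J → Fin 2) :
    bsign a (∑ j ∈ s, f j) = ∏ j ∈ s, bsign a (f j) := by
  classical
  induction s using Finset.induction_on with
  | empty => simp
  | insert j s hj ih => rw [Finset.sum_insert hj, Finset.prod_insert hj, bsign_add_right, ih]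

/-- The scalar `1 / √2`. -/
noncomputable def invSqrtTwo : ℂ := ((Real.sqrt 2)⁻¹ : ℝ)

lemma invSqrtTwo_mul_self : invSqrtTwo * invSqrtTwo = 1 / 2 := by
  have : (Real.sqrt 2)⁻¹ * (Real.sqrt 2)⁻¹ = 1 / 2 := by
    rw [← mul_inv, Real.mul_self_sqrt (by norm_num)]; norm_num
  rw [invSqrtTwo, ← Complex.ofReal_mul, this]; norm_num

/-- The Hadamard gate. -/
noncomputable def hadamard : Matrix.unitaryGroup (Fin 2) ℂ :=
  ⟨Matrix.of fun a b => invSqrtTwo * bsign a b, by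
    rw [Matrix.mem_unitaryGroup_iff]
    have h := invSqrtTwo_mul_self
    have hs : (starRingEnd ℂ) invSqrtTwo = invSqrtTwo := Complex.conj_ofReal _
    ext a b
    fin_cases a <;> fin_cases b <;>
      (simp [Matrix.mul_apply, Fin.sum_univ_two, bsign, hs, h]; try norm_num)⟩

lemma hadamard_apply (a b : Fin 2) : hadamard.1 a b = invSqrtTwo * bsign a b := rfl

/-- Conjugating a sign by Hadamard gates flips the bit. -/
lemma hadamard_sign_hadamard (g : Fin 2 → ℂ) (a f : Fin 2) :
    ∑ b, hadamard.1 a b * (bsign b f * ∑ c, hadamard.1 b c * g c) = g (a + f) := by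
  have h := invSqrtTwo_mul_self
  simp only [hadamard_apply, Fin.sum_univ_two]
  fin_cases a <;> fin_cases f <;> simp [bsign] <;>
    first
      | linear_combination (2 * g 0) * h
      | linear_combination (2 * g 1) * h

/-- The Pauli gate `X`. -/
def pauliX : Matrix.unitaryGroup (Fin 2) ℂ :=
  ⟨!![0, 1; 1, 0], by
    rw [Matrix.mem_unitaryGroup_iff]
    ext a b
    fin_cases a <;> fin_cases b <;> simp [Matrix.mul_apply, Fin.sum_univ_two]⟩

/-- The Pauli gate `Z`. -/
def pauliZ : Matrix.unitaryGroup (Fin 2) ℂ :=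
  ⟨!![1, 0; 0, -1], by
    rw [Matrix.mem_unitaryGroup_iff]
    ext a b
    fin_cases a <;> fin_cases b <;> simp [Matrix.mul_apply, Fin.sum_univ_two]⟩

/-- The gate that multiplies `|1⟩` by the phase `exp (i θ)`. -/
noncomputable def phaseGate (θ : ℝ) : Matrix.unitaryGroup (Fin 2) ℂ :=
  ⟨!![1, 0; 0, Complex.exp (Complex.I * θ)], by
    rw [Matrix.mem_unitaryGroup_iff]
    have : Complex.exp (Complex.I * θ) * (starRingEnd ℂ) (Complex.exp (Complex.I * θ)) = 1 := by
      rw [← Complex.exp_conj, ← Complex.exp_add]; simp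
    ext a b
    fin_cases a <;> fin_cases b <;> simp [Matrix.mul_apply, Fin.sum_univ_two, this]⟩

lemma sum_pauliX (g : Fin 2 → ℂ) (a : Fin 2) : ∑ b, pauliX.1 a b * g b = g (a + 1) := by
  fin_cases a <;> simp [pauliX]

lemma sum_pauliX_cond (p : Prop) [Decidable p] (b : Fin 2) (hp : p ↔ b = 1) (g : Fin 2 → ℂ)
    (a : Fin 2) :
    ∑ c, (if p then pauliX else 1 : Matrix.unitaryGroup (Fin 2) ℂ).1 a c * g c = g (a + b) := by
  by_cases h : p
  · rw [if_pos h, sum_pauliX, hp.1 h]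
  · have : b = 0 := by have := mt hp.2 h; omega
    simp [h, this, Matrix.one_apply]

lemma sum_phaseGate (θ : ℝ) (g : Fin 2 → ℂ) (a : Fin 2) :
    ∑ b, (phaseGate θ).1 a b * g b = (if a = 1 then Complex.exp (Complex.I * θ) else 1) * g a := by
  fin_cases a <;> simp [phaseGate]

/-- The rotation by the angle `t / 2`. -/
noncomputable def rotation (t : ℝ) : Matrix.unitaryGroup (Fin 2) ℂ :=
  ⟨!![(Real.cos (t / 2) : ℂ), -(Real.sin (t / 2) : ℂ); (Real.sin (t / 2) : ℂ),
      (Real.cos (t / 2) : ℂ)], by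
    rw [Matrix.mem_unitaryGroup_iff]
    have h : (Real.cos (t / 2) : ℂ) * Real.cos (t / 2) + Real.sin (t / 2) * Real.sin (t / 2) = 1 := by
      rw [← Complex.ofReal_mul, ← Complex.ofReal_mul, ← Complex.ofReal_add]
      have := Real.cos_sq_add_sin_sq (t / 2)
      rw [show Real.cos (t / 2) * Real.cos (t / 2) + Real.sin (t / 2) * Real.sin (t / 2) = 1 by
        linarith]
      simp
    ext a b
    fin_cases a <;> fin_cases b <;>
      simp only [Matrix.mul_apply, Fin.sum_univ_two, Matrix.star_apply, Matrix.of_apply,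
        Matrix.cons_val', Matrix.cons_val_zero, Matrix.cons_val_one, Matrix.cons_val_fin_one,
        Fin.zero_eta, Fin.mk_one, Matrix.one_apply, RCLike.star_def, Complex.conj_ofReal, map_neg,
        zero_ne_one, one_ne_zero, if_true, if_false] <;>
      first
        | linear_combination h
        | ring⟩

end OneQubit

end MFCircuit

namespace MFCircuit

/-! ### Sparse parity checks and the classical corrections they require. -/

section Gadget

/-- The qubits of a register `R` together with two registers of ancillas. -/
abbrev Ext (R V : Type) : Type := (R ⊕ V) ⊕ V

/-- The state `v ⊗ |0…0⟩` of a register and its ancillas. -/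
def extend {R V : Type} [Fintype V] (v : QState R) : QState (Ext R V) := fun y =>
  v (fun i => y (.inl (.inl i))) * (∏ j, if y (.inl (.inr j)) = 0 then 1 else 0) *
    ∏ j, if y (.inr j) = 0 then 1 else 0

lemma extend_smul {R V : Type} [Fintype V] (c : ℂ) (v : QState R) :
    (extend (c • v) : QState (Ext R V)) = c • extend v := by
  funext y
  simp only [extend, Pi.smul_apply, smul_eq_mul]
  ring

/-- The outcome of the last measurement layer. -/
def lastOutcome {ι : Type} (rec : MeasRecord ι) : ι → Fin 2 := rec.getLastD fun _ => 0

@[simp] lemma lastOutcome_append {ι : Type} (rec : MeasRecord ι) (o : ι → Fin 2) :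
    lastOutcome (rec ++ [o]) = o := by simp [lastOutcome]

lemma locL_pauliZ {J ι : Type} [DecidableEq ι] (l : List J) (q : J → ι) (κ : J → Prop)
    [DecidablePred κ] (w : QState ι) :
    locL l q (fun i => if κ i then pauliZ else 1) w =
      fun y => (l.map fun i => if κ i then bsign 1 (y (q i)) else 1).prod * w y := by
  induction l generalizing w with
  | nil => simp
  | cons i l ih =>
    have h : (QGate.single (q i) (if κ i then pauliZ else 1)).apply w =
        fun y => (if κ i then bsign 1 (y (q i)) else 1) * w y := by
      by_cases hκ : κ i
      · funext y
        have hu := Function.update_eq_self (q i) y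
        simp only [hκ, if_true, QGate.apply, Fin.sum_univ_two, pauliZ]
        have h : y (q i) = 0 ∨ y (q i) = 1 := by omega
        rcases h with h | h <;> rw [h] at hu ⊢ <;> simp [bsign, hu]
      · simp only [hκ, if_false, single_apply_one, one_mul]
    rw [locL_cons, h, ih]
    funext y
    rw [List.map_cons, List.prod_cons]
    ring

/-- Products of signs of coordinates. -/
def IsChar {R : Type} [Fintype R] (f : (R → Fin 2) → ℂ) : Prop :=
  ∃ κ : R → Bool, ∀ x, f x = ∏ i, if κ i then bsign 1 (x i) else 1

lemma fin_two_add_self (a : Fin 2) : a + a = 0 := by fin_cases a <;> rfl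

/-- The value of an optional bit. -/
def evalBit {R V : Type} (c : Option (R ⊕ V)) (x : R → Fin 2) (z : V → Fin 2) : Fin 2 :=
  c.elim 0 (Sum.elim x z)

lemma evalBit_add {R V : Type} (c : Option (R ⊕ V)) (x x' : R → Fin 2) (z z' : V → Fin 2) :
    evalBit c (x + x') (z + z') = evalBit c x z + evalBit c x' z' := by
  rcases c with _ | a | a <;> simp [evalBit]

variable {R : Type} [Fintype R]

lemma IsChar.one : IsChar (fun _ : R → Fin 2 => 1) := ⟨fun _ => false, fun x => by simp⟩

lemma IsChar.mul {f g : (R → Fin 2) → ℂ} (hf : IsChar f) (hg : IsChar g) :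
    IsChar fun x => f x * g x := by
  obtain ⟨κ, hκ⟩ := hf
  obtain ⟨κ', hκ'⟩ := hg
  refine ⟨fun i => xor (κ i) (κ' i), fun x => ?_⟩
  simp only [hκ, hκ']
  rw [← Finset.prod_mul_distrib]
  refine Finset.prod_congr rfl fun i _ => ?_
  by_cases h : κ i <;> by_cases h' : κ' i <;> simp [h, h']

lemma IsChar.coord [DecidableEq R] (i : R) : IsChar fun x : R → Fin 2 => bsign 1 (x i) :=
  ⟨fun j => decide (j = i), fun x => by simp⟩

lemma IsChar.prod {J : Type*} (s : Finset J) {f : J → (R → Fin 2) → ℂ}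
    (hf : ∀ j ∈ s, IsChar (f j)) : IsChar fun x => ∏ j ∈ s, f j x := by
  classical
  induction s using Finset.induction_on with
  | empty => simpa using IsChar.one
  | insert j s hj ih =>
    simp only [Finset.prod_insert hj]
    exact (hf j (Finset.mem_insert_self _ _)).mul
      (ih fun i hi => hf i (Finset.mem_insert_of_mem hi))

variable {V : Type} [Fintype V]

/-- A family of bits `sol x v` that are computed from the bits `x` by sparse parity checks. -/
structure ParityChecks (R V : Type) [Fintype R] [Fintype V] where
  c₁ : V → Option (R ⊕ V)
  c₂ : V → Option (R ⊕ V)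
  inj₁ : ∀ i j a, c₁ i = some a → c₁ j = some a → i = j
  inj₂ : ∀ i j a, c₂ i = some a → c₂ j = some a → i = j
  rank : V → ℕ
  rank₁ : ∀ i j, c₁ i = some (.inr j) → rank j < rank i
  rank₂ : ∀ i j, c₂ i = some (.inr j) → rank j < rank i
  sol : (R → Fin 2) → V → Fin 2
  sol_eq : ∀ x i, sol x i = evalBit (c₁ i) x (sol x) + evalBit (c₂ i) x (sol x)
  char : ∀ i, IsChar fun x => bsign 1 (sol x i)

namespace ParityChecks

variable (P : ParityChecks R V)

/-- The value of the parity check `i`. -/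
def check (x : R → Fin 2) (z : V → Fin 2) (i : V) : Fin 2 :=
  z i + evalBit (P.c₁ i) x z + evalBit (P.c₂ i) x z

lemma check_add (x x' : R → Fin 2) (z z' : V → Fin 2) :
    P.check (x + x') (z + z') = P.check x z + P.check x' z' := by
  funext i
  simp only [check, evalBit_add, Pi.add_apply]
  abel

lemma check_sol (x : R → Fin 2) : P.check x (P.sol x) = 0 := by
  funext i
  rw [check, add_assoc, ← P.sol_eq, fin_two_add_self, Pi.zero_apply]

/-- The system is triangular: check `i` involves, besides `z i`, only bits of smaller rank, so the
values of the checks determine `z` by induction on the rank. -/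
lemma check_injective (x : R → Fin 2) : Function.Injective (P.check x) := by
  intro z z' h
  funext i
  induction hn : P.rank i using Nat.strong_induction_on generalizing i with
  | _ n ih =>
    have hc : ∀ c : Option (R ⊕ V), (∀ j, c = some (.inr j) → P.rank j < P.rank i) →
        evalBit c x z = evalBit c x z' := by
      intro c hc
      rcases c with _ | a | a
      · rfl
      · rfl
      · exact ih _ (hn ▸ hc a rfl) a rfl
    have := congrFun h i
    rw [check, check, hc _ (P.rank₁ i), hc _ (P.rank₂ i)] at this
    exact add_right_cancel (add_right_cancel this)

/-- By linearity a solution for the outcome `o` is `P.sol x` plus a solution `β` of the homogeneous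
system at `x = 0`. Thus `β` is the same for all `x`, which lets classical feedback correct a
superposition over `x`. -/
lemma exists_correction (o : V → Fin 2) :
    ∃ β : V → Fin 2, ∀ x z, P.check x z = o ↔ ∀ i, z i = P.sol x i + β i := by
  classical
  obtain ⟨β, hβ⟩ := (Finite.injective_iff_surjective.1 (P.check_injective 0)) o
  refine ⟨β, fun x z => ?_⟩
  have h : P.check x (P.sol x + β) = o := by
    have := P.check_add x 0 (P.sol x) β
    rwa [add_zero, P.check_sol, zero_add, hβ] at this
  rw [← h, (P.check_injective x).eq_iff, funext_iff]
  rfl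

/-- The bits that have to be flipped when the checks have the values `o`. -/
noncomputable def correction (o : V → Fin 2) : V → Fin 2 := (P.exists_correction o).choose

lemma check_eq_iff (o : V → Fin 2) (x : R → Fin 2) (z : V → Fin 2) :
    P.check x z = o ↔ ∀ i, z i = P.sol x i + P.correction o i :=
  (P.exists_correction o).choose_spec x z

lemma char_sum (s : V → Fin 2) : IsChar fun x => ∏ i, bsign (s i) (P.sol x i) := by
  refine IsChar.prod _ fun i _ => ?_
  have h : s i = 0 ∨ s i = 1 := by omega
  rcases h with h | h
  · simpa [h] using IsChar.one
  · simpa [h] using P.char i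

/-- The qubits of the register that need a `Z` correction. -/
noncomputable def signCorrection (s : V → Fin 2) : R → Bool := (P.char_sum s).choose

lemma signCorrection_spec (s : V → Fin 2) (x : R → Fin 2) :
    ∏ i, bsign (s i) (P.sol x i) = ∏ i, if P.signCorrection s i then bsign 1 (x i) else 1 :=
  (P.char_sum s).choose_spec x

end ParityChecks

end Gadget

end MFCircuit

namespace MFCircuit

/-! ### The measurement circuit that applies phases to the solutions of parity checks. -/

namespace ParityChecks

set_option linter.unusedSectionVars false

variable {R V : Type} [Fintype R] [Fintype V] [DecidableEq R] [DecidableEq V]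
  (P : ParityChecks R V)

/-- The qubits of the register. -/
def qR : R → Ext R V := fun i => .inl (.inl i)

/-- The qubits of the computed bits. -/
def qV : V → Ext R V := fun i => .inl (.inr i)

/-- The qubits of the checks. -/
def qC : V → Ext R V := fun i => .inr i

/-- The qubits of the computed bits and of the checks. -/
def qVC : V ⊕ V → Ext R V := Sum.elim qV qC

lemma qR_injective : Function.Injective (qR : R → Ext R V) := fun _ _ h => by
  simpa [qR] using h

lemma qV_injective : Function.Injective (qV : V → Ext R V) := fun _ _ h => by
  simpa [qV] using h

lemma qC_injective : Function.Injective (qC : V → Ext R V) := fun _ _ h => by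
  simpa [qC] using h

lemma qVC_injective : Function.Injective (qVC : V ⊕ V → Ext R V) :=
  Function.Injective.sumElim qV_injective qC_injective (by simp [qV, qC])

lemma collapse_image (q : V → Ext R V) (hq : Function.Injective q) (o : Ext R V → Fin 2)
    (w : QState (Ext R V)) :
    collapse (Finset.univ.map ⟨q, hq⟩) o w =
      fun y => if ∀ i, y (q i) = o (q i) then w y else 0 := by
  funext y
  simp [collapse]

lemma restrictOutcome_image (q : V → Ext R V) (hq : Function.Injective q) (o : Ext R V → Fin 2)
    (i : V) : restrictOutcome (Finset.univ.map ⟨q, hq⟩) o (q i) = o (q i) := by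
  simp [restrictOutcome]

/-- The circuit that computes the bits of `P`, applies phases to them, and uncomputes them. -/
noncomputable def circuit (θ : V → ℝ) : MFCircuit (Ext R V) :=
  [localLayer Finset.univ.toList (Finset.nodup_toList _) qV qV_injective (fun _ => hadamard)
      (fun _ _ => true),
    -- The three CNOT layers write the check values, one summand each, into the check qubits. Each
    -- layer is legal because no qubit controls two of its gates.
    cnotLayer (fun i => some (.inr i)) (by simp +contextual),
    cnotLayer P.c₁ P.inj₁,
    cnotLayer P.c₂ P.inj₂,
    .measure (Finset.univ.map ⟨qC, qC_injective⟩),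
    localLayer Finset.univ.toList (Finset.nodup_toList _) qVC qVC_injective (fun _ => pauliX)
      (fun j rec => decide (j.elim (P.correction fun i => lastOutcome rec (qC i))
        (fun i => lastOutcome rec (qC i)) = 1)),
    localLayer Finset.univ.toList (Finset.nodup_toList _) qV qV_injective
      (fun i => phaseGate (θ i)) (fun _ _ => true),
    -- Measuring the computed bits in the Hadamard basis erases them without running the parity
    -- chain backwards.
    localLayer Finset.univ.toList (Finset.nodup_toList _) qV qV_injective (fun _ => hadamard)
      (fun _ _ => true),
    .measure (Finset.univ.map ⟨qV, qV_injective⟩),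
    localLayer Finset.univ.toList (Finset.nodup_toList _) qV qV_injective (fun _ => pauliX)
      (fun i rec => decide (lastOutcome rec (qV i) = 1)),
    localLayer Finset.univ.toList (Finset.nodup_toList _) qR qR_injective (fun _ => pauliZ)
      (fun i rec => P.signCorrection (fun j => lastOutcome rec (qV j)) i)]

/-- The phase that is applied. -/
noncomputable def phase (θ : V → ℝ) (x : R → Fin 2) : ℂ :=
  ∏ i, if P.sol x i = 1 then Complex.exp (Complex.I * θ i) else 1

lemma prod_ite_eq_ite_forall {J : Type} [Fintype J] (p : J → Prop) [DecidablePred p] :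
    ∏ j, (if p j then (1 : ℂ) else 0) = if ∀ j, p j then 1 else 0 := by
  simp [Finset.prod_ite_zero]

/-- The state after the parity checks are measured, up to normalisation. -/
lemma measured_checks (o : Ext R V → Fin 2) (v : QState R) :
    (collapse (Finset.univ.map ⟨qC, qC_injective⟩) o fun y : Ext R V → Fin 2 =>
      v (y ∘ qR) * ∏ i, if P.check (y ∘ qR) (y ∘ qV) i + y (qC i) = 0 then (1 : ℂ) else 0) =
    fun y => v (y ∘ qR) * ∏ j : V ⊕ V, if y (qVC j) = j.elim
      (fun i => P.sol (y ∘ qR) i + P.correction (fun i => o (qC i)) i) (fun i => o (qC i))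
      then 1 else 0 := by
  rw [collapse_image]
  funext y
  rw [Fintype.prod_sum_type]
  change _ = v (y ∘ qR) * ((∏ i, if y (qV i) = P.sol (y ∘ qR) i +
    P.correction (fun i => o (qC i)) i then 1 else 0) * ∏ i, if y (qC i) = o (qC i) then 1 else 0)
  rw [prod_ite_eq_ite_forall, prod_ite_eq_ite_forall, prod_ite_eq_ite_forall]
  by_cases h : ∀ i, y (qC i) = o (qC i)
  · have : (∀ j, P.check (y ∘ qR) (y ∘ qV) j + o (qC j) = 0) ↔
        ∀ j, y (qV j) = P.sol (y ∘ qR) j + P.correction (fun i => o (qC i)) j := by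
      refine Iff.trans ?_ (P.check_eq_iff (fun i => o (qC i)) (y ∘ qR) (y ∘ qV))
      rw [funext_iff]
      refine forall_congr' fun j => ?_
      omega
    simp only [h, this, implies_true, if_true, mul_one]
  · simp [h]

variable (θ : V → ℝ) (r : ℕ → Ext R V → Fin 2) (v : QState R)

lemma hadamard_extend :
    locL Finset.univ.toList qV (fun _ : V => hadamard) (extend v : QState (Ext R V)) =
      fun y => invSqrtTwo ^ Fintype.card V * (v (y ∘ qR) * ∏ i, if y (qC i) = 0 then 1 else 0) := by
  have h := locL_univ_prod (qV : V → Ext R V) qV_injective (fun _ => hadamard)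
    (fun y => v (y ∘ qR) * ∏ i : V, if y (qC i) = 0 then 1 else 0)
    (fun _ _ a => if a = 0 then 1 else 0)
    (by
      intro x j c
      have : Function.update x (qV j) c ∘ qR = x ∘ qR := by
        funext i; simp [qR, qV]
      rw [this]
      congr 1)
    (fun _ _ _ _ => rfl)
  convert h using 1
  · congr 1
    funext y
    simp only [extend]
    rw [mul_right_comm]
    rfl
  · funext y
    simp [hadamard_apply, mul_comm]

/-- The `X` gates shift each computed bit by `β` and each check qubit by its outcome: the former
then hold the solution and the latter are 0. -/
lemma locL_correction (o β : V → Fin 2) (cond : V ⊕ V → Prop) [DecidablePred cond]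
    (hc : ∀ j, cond j ↔ j.elim β o = 1) :
    locL Finset.univ.toList qVC (fun j => if cond j then pauliX else 1)
      (fun y : Ext R V → Fin 2 => v (y ∘ qR) * ∏ j : V ⊕ V, if y (qVC j) = j.elim
        (fun i => P.sol (y ∘ qR) i + β i) o then 1 else 0) =
      fun y => v (y ∘ qR) * (∏ i, if y (qC i) = 0 then 1 else 0) *
        ∏ i, if y (qV i) = P.sol (y ∘ qR) i then 1 else 0 := by
  have hu : ∀ (x : Ext R V → Fin 2) (j : V ⊕ V) c, Function.update x (qVC j) c ∘ qR = x ∘ qR := by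
    intro x j c
    funext i
    rcases j with j | j <;> simp [qR, qV, qC, qVC]
  rw [locL_univ_prod (qVC : V ⊕ V → Ext R V) qVC_injective _ (fun y => v (y ∘ qR))
    (fun j y a => if a = j.elim (fun i => P.sol (y ∘ qR) i + β i) o then 1 else 0)
    (fun x j c => by rw [hu]) (fun i x j c => by simp only [hu])]
  funext y
  simp only [sum_pauliX_cond _ _ (hc _)]
  rw [Fintype.prod_sum_type, mul_assoc, mul_comm (∏ i : V, _)]
  congr 2
  · refine Finset.prod_congr rfl fun i _ => ?_
    simp [qVC]
  · refine Finset.prod_congr rfl fun i _ => ?_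
    simp [qVC]

lemma locL_phase_hadamard :
    locL Finset.univ.toList qV (fun _ => hadamard)
      (locL Finset.univ.toList qV (fun i => phaseGate (θ i))
        (fun y : Ext R V → Fin 2 => v (y ∘ qR) * (∏ i, if y (qC i) = 0 then 1 else 0) *
        ∏ i, if y (qV i) = P.sol (y ∘ qR) i then 1 else 0)) =
      fun y => v (y ∘ qR) * (∏ i, if y (qC i) = 0 then 1 else 0) *
        (invSqrtTwo ^ Fintype.card V * P.phase θ (y ∘ qR) *
        ∏ i, bsign (y (qV i)) (P.sol (y ∘ qR) i)) := by
  have hu : ∀ (x : Ext R V → Fin 2) (j : V) c, Function.update x (qV j) c ∘ qR = x ∘ qR := by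
    intro x j c
    funext i
    simp [qR, qV]
  have hK : ∀ (x : Ext R V → Fin 2) (j : V) c,
      v (Function.update x (qV j) c ∘ qR) * ∏ i : V, (if Function.update x (qV j) c (qC i) = 0
        then (1 : ℂ) else 0) = v (x ∘ qR) * ∏ i : V, if x (qC i) = 0 then 1 else 0 := by
    intro x j c
    rw [hu]
    congr 1
  rw [locL_univ_prod (qV : V → Ext R V) qV_injective _
    (fun y => v (y ∘ qR) * ∏ i : V, if y (qC i) = 0 then (1 : ℂ) else 0)
    (fun i y a => if a = P.sol (y ∘ qR) i then 1 else 0) hK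
    (fun i x j c => by simp only [hu])]
  simp only [sum_phaseGate]
  rw [locL_univ_prod (qV : V → Ext R V) qV_injective _
    (fun y => v (y ∘ qR) * ∏ i : V, if y (qC i) = 0 then (1 : ℂ) else 0)
    (fun i y a => (if a = 1 then Complex.exp (Complex.I * θ i) else 1) *
      if a = P.sol (y ∘ qR) i then 1 else 0) hK
    (fun i x j c => by simp only [hu])]
  funext y
  congr 1
  rw [phase, mul_assoc, ← Finset.prod_mul_distrib, ← Finset.card_univ, ← Finset.prod_const,
    ← Finset.prod_mul_distrib]
  refine Finset.prod_congr rfl fun i _ => ?_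
  simp only [hadamard_apply, mul_ite, mul_one, mul_zero, Finset.sum_ite_eq', Finset.mem_univ,
    if_true]
  split_ifs <;> ring

/-- The scalar `s * s` does not depend on the outcomes: they are uniformly random and reveal nothing
about `x`. -/
lemma branch_circuit : ∃ c : ℂ, ∀ rec v,
    branch r (P.circuit θ) rec (extend v) = c • extend fun x => P.phase θ x * v x := by
  set s := invSqrtTwo ^ Fintype.card V with hs
  refine ⟨s * s, fun rec v => ?_⟩
  rw [circuit, branch_localLayer]
  simp only [if_true]
  rw [hadamard_extend, branch_cnotLayer, branch_cnotLayer, branch_cnotLayer]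
  refine (congrArg (branch r _ rec) (?_ : _ = s • fun y : Ext R V → Fin 2 => v (y ∘ qR) *
    ∏ i, if P.check (y ∘ qR) (y ∘ qV) i + y (qC i) = 0 then (1 : ℂ) else 0)).trans ?_
  · funext y
    simp only [Pi.smul_apply, smul_eq_mul, hs]
    congr 2
    refine Finset.prod_congr rfl fun i _ => ?_
    refine if_congr ?_ rfl rfl
    have h : ∀ c : Option (R ⊕ V), (c.elim 0 fun a => y (.inl a)) =
        evalBit c (y ∘ qR) (y ∘ qV) := by
      intro c
      rcases c with _ | a | a <;> rfl
    have h₀ : evalBit (some (.inr i)) (y ∘ qR) (y ∘ qV) = y (qV i) := rfl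
    simp only [qC, Sum.elim_inr, Function.comp_apply, Sum.elim_inl, h, check, h₀]
    rw [show ∀ a b c d : Fin 2, a + b + c + d = d + c + b + a from fun a b c d => by abel]
  rw [branch_smul, mul_smul]
  congr 1
  rw [branch, measured_checks, branch_localLayer]
  simp only [lastOutcome_append, restrictOutcome_image]
  rw [P.locL_correction v (fun i => r rec.length (qC i)) _ _ (by simp), branch_localLayer,
    branch_localLayer]
  simp only [if_true]
  rw [locL_phase_hadamard, branch, collapse_image, branch_localLayer, branch_localLayer, branch]
  simp only [lastOutcome_append, restrictOutcome_image]
  generalize r (rec ++ [restrictOutcome (Finset.univ.map ⟨qC, qC_injective⟩)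
    (r rec.length)]).length = o
  have hu : ∀ (x : Ext R V → Fin 2) (j : V) c, Function.update x (qV j) c ∘ qR = x ∘ qR := by
    intro x j c
    funext i
    simp [qR, qV]
  have h1 : (fun y : Ext R V → Fin 2 => if ∀ i, y (qV i) = o (qV i) then
      v (y ∘ qR) * (∏ i, if y (qC i) = 0 then 1 else 0) * (invSqrtTwo ^ Fintype.card V *
        P.phase θ (y ∘ qR) * ∏ i, bsign (y (qV i)) (P.sol (y ∘ qR) i)) else 0) =
      fun y => v (y ∘ qR) * (∏ i, if y (qC i) = 0 then 1 else 0) * (s *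
        P.phase θ (y ∘ qR) * ∏ i, bsign (o (qV i)) (P.sol (y ∘ qR) i)) *
        ∏ i, if y (qV i) = o (qV i) then 1 else 0 := by
    funext y
    rw [prod_ite_eq_ite_forall fun i => y (qV i) = o (qV i)]
    by_cases h : ∀ i, y (qV i) = o (qV i)
    · rw [if_pos h, if_pos h, mul_one]
      simp only [h]
      rfl
    · rw [if_neg h, if_neg h, mul_zero]
  rw [h1, locL_univ_prod (qV : V → Ext R V) qV_injective _ _ (fun i y a => if a = o (qV i) then 1 else 0)
    (fun x j c => by simp only [hu]; rfl) (fun i x j c => rfl)]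
  simp only [sum_pauliX_cond _ (o (qV _)) decide_eq_true_iff]
  rw [locL_pauliZ]
  funext y
  have h2 := P.signCorrection_spec (fun j => o (qV j)) (y ∘ qR)
  -- The sign left by the second measurement and the one from the `Z` corrections are equal, so they
  -- cancel.
  have h3 : (∏ i, bsign (o (qV i)) (P.sol (y ∘ qR) i)) * ∏ i, bsign (o (qV i)) (P.sol (y ∘ qR) i) = 1 := by
    rw [← Finset.prod_mul_distrib]
    simp
  simp only [Pi.smul_apply, smul_eq_mul, extend]
  rw [Finset.prod_map_toList]
  change (∏ i, if P.signCorrection (fun j => o (qV j)) i = true then bsign 1 ((y ∘ qR) i) else 1) * _ = _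
  rw [← h2]
  simp only [add_eq_right]
  change _ = s * (P.phase θ (y ∘ qR) * v (y ∘ qR) * (∏ i, if y (qV i) = 0 then 1 else 0) *
    ∏ i, if y (qC i) = 0 then 1 else 0)
  linear_combination (s * (P.phase θ (y ∘ qR) * v (y ∘ qR) *
    (∏ i, if y (qV i) = 0 then 1 else 0) * ∏ i, if y (qC i) = 0 then 1 else 0)) * h3

lemma depth_circuit : depth (P.circuit θ) = 11 := rfl

lemma measLayers_circuit : measLayers (P.circuit θ) = 2 := rfl

end ParityChecks
end MFCircuit

namespace MFCircuit

/-! ### Which diagonal operators are products of phases of running parities, and at what length. -/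

section PhaseFunctions

variable {R : Type}

/-- The running parities of the sequence of bits `x (src e)`, restarted at the positions marked
by `new`. -/
def runningParity (src : ℕ → R) (new : ℕ → Bool) (x : R → Fin 2) : ℕ → Fin 2
  | 0 => x (src 0)
  | e + 1 => x (src (e + 1)) + if new (e + 1) then 0 else runningParity src new x e

/-- The function `d` is, up to a scalar, a product of phases of `N` running parities. -/
def HasPhase (N : ℕ) (d : (R → Fin 2) → ℂ) : Prop :=
  ∃ (src : ℕ → R) (new : ℕ → Bool) (θ : ℕ → ℝ) (c : ℂ), c ≠ 0 ∧ ∀ x, d x = c *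
    ∏ e ∈ Finset.range N, if runningParity src new x e = 1 then Complex.exp (Complex.I * θ e) else 1

lemma HasPhase.ne_zero {N : ℕ} {d : (R → Fin 2) → ℂ} (h : HasPhase N d) (x : R → Fin 2) :
    d x ≠ 0 := by
  obtain ⟨src, new, θ, c, hc, h⟩ := h
  rw [h]
  refine mul_ne_zero hc (Finset.prod_ne_zero_iff.2 fun e _ => ?_)
  split_ifs
  · exact Complex.exp_ne_zero _
  · exact one_ne_zero

lemma HasPhase.inv {N : ℕ} {d : (R → Fin 2) → ℂ} (h : HasPhase N d) :
    HasPhase N fun x => (d x)⁻¹ := by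
  obtain ⟨src, new, θ, c, hc, h⟩ := h
  refine ⟨src, new, fun e => -θ e, c⁻¹, inv_ne_zero hc, fun x => ?_⟩
  simp only [h]
  rw [mul_inv, ← Finset.prod_inv_distrib]
  congr 1
  refine Finset.prod_congr rfl fun e _ => ?_
  split_ifs
  · rw [← Complex.exp_neg]; push_cast; ring_nf
  · simp

/-- Forcing a restart at position `N` decouples the second sequence from the first; this is what
makes the lengths of products additive. -/
lemma runningParity_append (src src' : ℕ → R) (new new' : ℕ → Bool) (x : R → Fin 2) (N : ℕ)
    (e : ℕ) :
    runningParity (fun i => if i < N then src i else src' (i - N))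
      (fun i => if i < N then new i else decide (i = N) || new' (i - N)) x e =
      if e < N then runningParity src new x e else runningParity src' new' x (e - N) := by
  induction e with
  | zero =>
    rcases Nat.eq_zero_or_pos N with rfl | hN
    · simp [runningParity]
    · simp [runningParity, hN]
  | succ e ih =>
    rw [runningParity, ih]
    rcases lt_trichotomy (e + 1) N with h | h | h
    · simp [runningParity, h, show e < N by omega]
    · subst h
      simp [runningParity]
    · have h1 : e + 1 - N = (e - N) + 1 := by omega
      simp [show ¬ e + 1 < N by omega, show ¬ e < N by omega, show ¬ e + 1 = N by omega, h1,
        runningParity]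

lemma HasPhase.mul {N N' : ℕ} {d d' : (R → Fin 2) → ℂ} (h : HasPhase N d) (h' : HasPhase N' d') :
    HasPhase (N + N') fun x => d x * d' x := by
  obtain ⟨src, new, θ, c, hc, h⟩ := h
  obtain ⟨src', new', θ', c', hc', h'⟩ := h'
  refine ⟨fun i => if i < N then src i else src' (i - N),
    fun i => if i < N then new i else decide (i = N) || new' (i - N),
    fun i => if i < N then θ i else θ' (i - N), c * c', mul_ne_zero hc hc', fun x => ?_⟩
  simp only [h, h', runningParity_append src src' new new' x N]
  rw [Finset.prod_range_add, mul_mul_mul_comm]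
  congr 2
  · refine Finset.prod_congr rfl fun e he => ?_
    simp [Finset.mem_range.1 he]
  · simp

lemma HasPhase.const [Nonempty R] (N : ℕ) {c : ℂ} (hc : c ≠ 0) :
    HasPhase N fun _ : R → Fin 2 => c :=
  ⟨fun _ => Classical.arbitrary R, fun _ => true, fun _ => 0, c, hc, fun x => by simp⟩

lemma HasPhase.mono [Nonempty R] {N N' : ℕ} {d : (R → Fin 2) → ℂ} (h : HasPhase N d)
    (hN : N ≤ N') : HasPhase N' d := by
  have := h.mul (HasPhase.const (R := R) (N' - N) one_ne_zero)
  simpa [Nat.add_sub_cancel' hN] using this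

lemma HasPhase.prod [Nonempty R] {J : Type*} (s : Finset J) {d : J → (R → Fin 2) → ℂ} {N : ℕ}
    (h : ∀ j ∈ s, HasPhase N (d j)) : HasPhase (s.card * N) fun x => ∏ j ∈ s, d j x := by
  classical
  induction s using Finset.induction_on with
  | empty => simpa using HasPhase.const (R := R) 0 one_ne_zero
  | insert j s hj ih =>
    simp only [Finset.prod_insert hj, Finset.card_insert_of_notMem hj]
    have := (h j (Finset.mem_insert_self _ _)).mul
      (ih fun i hi => h i (Finset.mem_insert_of_mem hi))
    rwa [add_mul, one_mul, add_comm]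

/-- The sign of the parity of a list of bits. -/
def listSign (t : List R) (x : R → Fin 2) : ℝ := (t.map fun i => if x i = 1 then -1 else 1).prod

lemma hasPhase_listSign [Nonempty R] (t : List R) (θ : ℝ) :
    HasPhase t.length fun x => Complex.exp (Complex.I * (θ * listSign t x : ℝ)) := by
  rcases t.eq_nil_or_concat' with rfl | ⟨t, a, rfl⟩
  · simpa [listSign] using HasPhase.const (R := R) 0 (Complex.exp_ne_zero _)
  set u := t ++ [a] with hu
  have hlen : u.length = t.length + 1 := by simp [hu]
  have hpar : ∀ x e (he : e < u.length), listSign (u.take (e + 1)) x =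
      if runningParity (fun i => u.getD i a) (fun _ => false) x e = 1 then -1 else 1 := by
    intro x e
    induction e with
    | zero =>
      intro he
      rw [List.take_one, List.head?_eq_getElem?, List.getElem?_eq_getElem he]
      simp [listSign, runningParity, List.getElem?_eq_getElem he]
    | succ e ih =>
      intro he
      have hs : ∀ b c : Fin 2, (if b + c = 1 then (-1 : ℝ) else 1) =
          (if c = 1 then -1 else 1) * if b = 1 then -1 else 1 := by
        intro b c
        fin_cases b <;> fin_cases c <;> simp
      rw [List.take_add_one, List.getElem?_eq_getElem he, runningParity]
      have := ih (by omega)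
      simp only [listSign, List.map_append, List.prod_append] at this ⊢
      rw [this]
      simp [hs, List.getElem?_eq_getElem he]
  -- For a sign `s`, `exp (i θ s)` is `exp (i θ)` times `exp (-2 i θ)` when `s = -1`. Only the last
  -- running parity is the parity of the whole list, so only it gets an angle.
  refine ⟨fun i => u.getD i a, fun _ => false, fun e => if e = t.length then -2 * θ else 0,
    Complex.exp (Complex.I * θ), Complex.exp_ne_zero _, fun x => ?_⟩
  have h1 := hpar x t.length (by omega)
  rw [show u.take (t.length + 1) = u from List.take_of_length_le (by omega)] at h1
  simp only
  rw [hlen, Finset.prod_range_succ, Finset.prod_eq_one, one_mul, h1,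
    if_pos rfl]
  · split_ifs
    · rw [← Complex.exp_add]
      congr 1
      push_cast
      ring
    · simp
  · intro e he
    have : e ≠ t.length := (Finset.mem_range.1 he).ne
    simp [this]

lemma listSign_cons (i : R) (t : List R) (x : R → Fin 2) :
    listSign (i :: t) x = (if x i = 1 then -1 else 1) * listSign t x := by
  simp [listSign]

/-- Expand the conjunction one literal at a time: the indicator of `a = b` is half of `1` plus or
minus the sign of `a`. Each literal doubles the number of parities and lengthens them by at most one
bit. -/
lemma hasPhase_listSign_and [Nonempty R] (l : List (R × Fin 2)) (t : List R) (θ : ℝ) :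
    HasPhase (2 ^ l.length * (t.length + l.length)) fun x => Complex.exp (Complex.I *
      (θ * (listSign t x * if ∀ p ∈ l, x p.1 = p.2 then 1 else 0) : ℝ)) := by
  induction l generalizing t θ with
  | nil => simpa using hasPhase_listSign t θ
  | cons p l ih =>
    have h := (ih t (θ / 2)).mul (ih (p.1 :: t) (if p.2 = 1 then -(θ / 2) else θ / 2))
    convert h.mono (N' := 2 ^ (p :: l).length * (t.length + (p :: l).length)) ?_ using 2 with x
    · rw [← Complex.exp_add, ← mul_add, ← Complex.ofReal_add]
      congr 3
      have h2 : ∀ a b : Fin 2, (if a = b then (1 : ℝ) else 0) = 1 / 2 +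
          (if b = 1 then -(1 / 2) else 1 / 2) * if a = 1 then -1 else 1 := by
        intro a b
        fin_cases a <;> fin_cases b <;> norm_num
      have h3 : (if ∀ q ∈ p :: l, x q.1 = q.2 then (1 : ℝ) else 0) =
          (if x p.1 = p.2 then 1 else 0) * if ∀ q ∈ l, x q.1 = q.2 then 1 else 0 := by
        simp only [List.forall_mem_cons, ite_and]
        split_ifs <;> simp
      rw [h3, h2, listSign_cons]
      split_ifs <;> ring
    · simp only [List.length_cons, pow_succ]
      nlinarith [Nat.zero_le (2 ^ l.length)]

/-- A phase controlled by the conjunction of a list of literals. -/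
lemma hasPhase_and [Nonempty R] (l : List (R × Fin 2)) (θ : ℝ) :
    HasPhase (2 ^ l.length * l.length) fun x =>
      if ∀ p ∈ l, x p.1 = p.2 then Complex.exp (Complex.I * θ) else 1 := by
  convert hasPhase_listSign_and l [] θ using 2 with x
  · simp
  · simp only [listSign, List.map_nil, List.prod_nil, one_mul]
    split_ifs <;> simp

end PhaseFunctions

/-! ### Parity checks for a sequence of running parities. -/

section ChecksOfSequence

variable {R : Type} [Fintype R] [DecidableEq R] (N : ℕ) (src : ℕ → R) (new : ℕ → Bool)

/-- The earlier positions of the sequence that hold the same bit. -/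
def earlier (e : Fin N) : Finset (Fin N) :=
  Finset.univ.filter fun e' => e' < e ∧ src e' = src e

lemma isChar_runningParity (e : ℕ) :
    IsChar fun x : R → Fin 2 => bsign 1 (runningParity src new x e) := by
  induction e with
  | zero => exact IsChar.coord _
  | succ e ih =>
    cases h : new (e + 1)
    · simpa [runningParity, h, bsign_add_right] using (IsChar.coord (src (e + 1))).mul ih
    · simpa [runningParity, h] using IsChar.coord (src (e + 1))

/-- Sparse parity checks for the copies of the bits of a sequence and its running parities. -/
def sequenceChecks : ParityChecks R (Fin N ⊕ Fin N) where
  -- A copy is checked against the preceding copy of the same bit, not against the bit itself, and a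
  -- running parity against its predecessor and its own copy. Thus no qubit controls two gates of a
  -- layer.
  c₁ := Sum.elim
    (fun e => some (if h : (earlier N src e).Nonempty then .inr (.inl ((earlier N src e).max' h))
      else .inl (src e)))
    (fun e => if 0 < e.val ∧ new e = false then some (.inr (.inr ⟨e.val - 1, by omega⟩)) else none)
  c₂ := Sum.elim (fun _ => none) fun e => some (.inr (.inl e))
  inj₁ := by
    -- If `i < j` have the same control, they hold the same bit, so `i` is an earlier occurrence for
    -- `j`. The last occurrence before `j` is then at least `i`, hence not the last one before `i`.
    have key : ∀ (i j : Fin N) (a : R ⊕ (Fin N ⊕ Fin N)), i < j →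
        (if h : (earlier N src i).Nonempty then
          (.inr (.inl ((earlier N src i).max' h)) : R ⊕ (Fin N ⊕ Fin N)) else .inl (src i)) = a →
        (if h : (earlier N src j).Nonempty then
          (.inr (.inl ((earlier N src j).max' h)) : R ⊕ (Fin N ⊕ Fin N)) else .inl (src j)) = a →
        False := by
      intro i j a hij hi hj
      have hmem : ∀ hs : src i = src j, i ∈ earlier N src j := fun hs => by
        simp [earlier, hij, hs]
      rw [← hj] at hi
      split_ifs at hi with h1 h2
      · have h3 : (earlier N src i).max' h1 = (earlier N src j).max' h2 := by simpa using hi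
        have h4 := Finset.max'_mem _ h1
        have h5 := Finset.max'_mem _ h2
        rw [← h3] at h5
        simp only [earlier, Finset.mem_filter, Finset.mem_univ, true_and] at h4 h5
        have h6 := Finset.le_max' _ _ (hmem (h4.2.symm.trans h5.2))
        rw [← h3] at h6
        exact absurd h4.1 (not_lt.2 h6)
      · rename_i h2
        exact h2 ⟨i, hmem (by simpa using hi)⟩
    rintro (i | i) (j | j) a hi hj
    · simp only [Sum.elim_inl, Option.some.injEq] at hi hj
      rcases lt_trichotomy i j with h | h | h
      · exact (key i j a h hi hj).elim
      · rw [h]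
      · exact (key j i a h hj hi).elim
    · exfalso
      simp only [Sum.elim_inl, Sum.elim_inr, Option.some.injEq] at hi hj
      rw [← hi] at hj
      split_ifs at hj <;> simp at hj
    · exfalso
      simp only [Sum.elim_inl, Sum.elim_inr, Option.some.injEq] at hi hj
      rw [← hj] at hi
      split_ifs at hi <;> simp at hi
    · simp only [Sum.elim_inr] at hi hj
      rw [← hj] at hi
      split_ifs at hi hj with h1 h2
      simp only [Option.some.injEq, Sum.inr.injEq, Fin.mk.injEq] at hi
      congr 1
      ext
      omega
  inj₂ := by
    rintro (i | i) (j | j) a hi hj <;> simp at hi hj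
    rw [← hj] at hi
    simpa using hi
  rank := Sum.elim (fun e => e) fun e => N + e
  rank₁ := by
    rintro (i | i) (j | j) h <;> simp only [Sum.elim_inl, Sum.elim_inr, Option.some.injEq] at h ⊢
    · split_ifs at h with h1
      have h4 := Finset.max'_mem _ h1
      simp only [Sum.inr.injEq, Sum.inl.injEq] at h
      rw [h] at h4
      simp only [earlier, Finset.mem_filter] at h4
      exact h4.2.1
    · split_ifs at h with h1
      simp at h
    · split_ifs at h with h1
      simp at h
    · split_ifs at h with h1
      simp only [Option.some.injEq, Sum.inr.injEq] at h
      rw [← h]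
      simp only
      omega
  rank₂ := by
    rintro (i | i) (j | j) h <;> simp at h ⊢
    omega
  sol x := Sum.elim (fun e => x (src e)) fun e => runningParity src new x e
  sol_eq x := by
    rintro (e | e)
    · simp only [Sum.elim_inl, evalBit, Option.elim_some, Option.elim_none, add_zero]
      split_ifs with h1
      · have h4 : src ((earlier N src e).max' h1 : Fin N) = src e :=
          (Finset.mem_filter.1 (Finset.max'_mem (earlier N src e) h1)).2.2
        simp [h4]
      · simp
    · obtain ⟨e, he⟩ := e
      rcases e with _ | e
      · simp [evalBit, runningParity]
      · cases h : new (e + 1) <;> simp [evalBit, runningParity, h, add_comm]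
  char := by
    rintro (e | e)
    · exact IsChar.coord _
    · exact isChar_runningParity _ _ _

end ChecksOfSequence

end MFCircuit

namespace MFCircuit

/-! ### Operators implemented by circuits up to scalars, and diagonal operators conjugated by local
gates. -/

section Simulation

set_option linter.unusedSectionVars false

variable {R : Type} [Fintype R] [DecidableEq R]

/-- The operator `T` is implemented, up to scalars, by a circuit with `4 * N` ancillas, whatever
the outcomes of its measurements. -/
def Sim (N dep meas : ℕ) (T : QState R → QState R) : Prop :=
  ∃ C : MFCircuit (Ext R (Fin N ⊕ Fin N)), depth C ≤ dep ∧ measLayers C ≤ meas ∧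
    ∀ r rec v, ∃ c : ℂ, branch r C rec (extend v) = c • extend (T v)

lemma Sim.comp {N a b a' b' : ℕ} {T T' : QState R → QState R} (h' : Sim N a' b' T')
    (h : Sim N a b T) : Sim N (a + a') (b + b') (T' ∘ T) := by
  obtain ⟨C, h1, h2, h3⟩ := h
  obtain ⟨C', h1', h2', h3'⟩ := h'
  refine ⟨C ++ C', ?_, ?_, fun r rec v => ?_⟩
  · rw [depth, List.length_append]
    exact add_le_add h1 h1'
  · rw [measLayers_append]
    exact add_le_add h2 h2'
  · obtain ⟨rec', hr⟩ := exists_branch_append r C C' rec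
    obtain ⟨c, hc⟩ := h3 r rec v
    obtain ⟨c', hc'⟩ := h3' r rec' (T v)
    refine ⟨c * c', ?_⟩
    rw [hr, hc, branch_smul, hc', smul_smul]
    rfl

lemma locL_extend {V J : Type} [Fintype V] [DecidableEq V] (l : List J) (q : J → R)
    (U : J → Matrix.unitaryGroup (Fin 2) ℂ) (v : QState R) :
    locL l (fun j => (.inl (.inl (q j)) : Ext R V)) U (extend v) = extend (locL l q U v) := by
  induction l generalizing v with
  | nil => rfl
  | cons j l ih =>
    rw [locL_cons, locL_cons, ← ih]
    congr 1
    funext y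
    have hu : ∀ b, (fun i => Function.update y (.inl (.inl (q j))) b (.inl (.inl i) : Ext R V)) =
        Function.update (fun i => y (.inl (.inl i))) (q j) b := by
      intro b
      funext i
      by_cases h : i = q j
      · subst h; simp
      · simp [h]
    simp only [QGate.apply, extend, hu, Finset.sum_mul, mul_assoc]
    congr 1

/-- The unitaries `U j` on the qubits `q j` of the register. -/
noncomputable def loc {J : Type} [Fintype J] (q : J → R) (U : J → Matrix.unitaryGroup (Fin 2) ℂ) :
    QState R → QState R := locL Finset.univ.toList q U

/-- The multiplication of the amplitudes by the function `d`. -/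
def diag (d : (R → Fin 2) → ℂ) : QState R → QState R := fun v x => d x * v x

lemma sim_locL (N : ℕ) {J : Type} (l : List J) (hl : l.Nodup) (q : J → R)
    (hq : Function.Injective q) (U : J → Matrix.unitaryGroup (Fin 2) ℂ) :
    Sim N 1 0 (locL l q U) := by
  have hq' : Function.Injective fun j => (.inl (.inl (q j)) : Ext R (Fin N ⊕ Fin N)) :=
    fun a b h => hq (by simpa using h)
  refine ⟨[localLayer l hl _ hq' U fun _ _ => true], le_rfl, le_rfl, fun r rec v => ⟨1, ?_⟩⟩
  rw [branch_localLayer, branch, one_smul, ← locL_extend]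
  rfl

lemma sim_diag {N : ℕ} {d : (R → Fin 2) → ℂ} (hd : HasPhase N d) : Sim N 11 2 (diag d) := by
  obtain ⟨src, new, θ, c, hc, h⟩ := hd
  set P := sequenceChecks N src new with hP
  -- The copies carry angle 0; only the running parities receive phases.
  refine ⟨P.circuit (Sum.elim 0 fun e => θ e), P.depth_circuit _ |>.le, P.measLayers_circuit _ |>.le,
    fun r rec v => ?_⟩
  obtain ⟨c', h'⟩ := P.branch_circuit (Sum.elim 0 fun e => θ e) r
  have hs : (fun x => P.phase (Sum.elim 0 fun e => θ e) x * v x) = c⁻¹ • diag d v := by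
    funext x
    have : d x = c * P.phase (Sum.elim 0 fun e => θ e) x := by
      rw [h, ParityChecks.phase, Fintype.prod_sum_type, ← Fin.prod_univ_eq_prod_range
        (fun e => if runningParity src new x e = 1 then Complex.exp (Complex.I * θ e) else 1)]
      simp [hP, sequenceChecks]
    simp only [diag, Pi.smul_apply, smul_eq_mul, this]
    field_simp
  exact ⟨c' * c⁻¹, by rw [h', hs, extend_smul, smul_smul]⟩

/-- The operator `T` and a left inverse of it are implemented by circuits. -/
def RevSim (N dep meas : ℕ) (T : QState R → QState R) : Prop :=
  Sim N dep meas T ∧ ∃ T', Function.LeftInverse T' T ∧ Sim N dep meas T'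

lemma RevSim.comp {N a b a' b' : ℕ} {T T' : QState R → QState R} (h' : RevSim N a' b' T')
    (h : RevSim N a b T) : RevSim N (a + a') (b + b') (T' ∘ T) := by
  obtain ⟨h, S, hS, hs⟩ := h
  obtain ⟨h', S', hS', hs'⟩ := h'
  refine ⟨h'.comp h, S ∘ S', fun v => ?_, ?_⟩
  · simp only [Function.comp_apply, hS' _, hS _]
  · rw [add_comm a, add_comm b]
    exact hs.comp hs'

lemma revSim_loc (N : ℕ) {J : Type} [Fintype J] (q : J → R)
    (hq : Function.Injective q) (U : J → Matrix.unitaryGroup (Fin 2) ℂ) :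
    RevSim N 1 0 (loc q U) :=
  ⟨sim_locL N _ (Finset.nodup_toList _) q hq U, locL Finset.univ.toList.reverse q fun j => (U j)⁻¹,
    locL_reverse_inv _ q U, sim_locL N _ (List.nodup_reverse.2 (Finset.nodup_toList _)) q hq _⟩

lemma revSim_diag {N : ℕ} {d : (R → Fin 2) → ℂ} (hd : HasPhase N d) :
    RevSim N 11 2 (diag d) :=
  ⟨sim_diag hd, diag fun x => (d x)⁻¹, fun v => by
    funext x
    simp [diag, hd.ne_zero x], sim_diag hd.inv⟩

/-- Phases conjugated by unitaries. -/
noncomputable def conjDiag {J : Type} [Fintype J] (q : J → R)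
    (U U' : J → Matrix.unitaryGroup (Fin 2) ℂ) (d : (R → Fin 2) → ℂ) : QState R → QState R := loc q U' ∘ diag d ∘ loc q U

lemma revSim_conjDiag {N : ℕ} {J : Type} [Fintype J] (q : J → R) (hq : Function.Injective q)
    (U U' : J → Matrix.unitaryGroup (Fin 2) ℂ) {d : (R → Fin 2) → ℂ} (hd : HasPhase N d) :
    RevSim N 13 2 (conjDiag q U U' d) :=
  (revSim_loc N q hq U').comp ((revSim_diag hd).comp (revSim_loc N q hq U))

/-- The action of `conjDiag` on states that are products over the qubits `q j`. -/
lemma conjDiag_prod {J : Type} [Fintype J] [DecidableEq J] (q : J → R)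
    (hq : Function.Injective q) (U U' : J → Matrix.unitaryGroup (Fin 2) ℂ)
    (K k : (R → Fin 2) → ℂ) (g e : J → (R → Fin 2) → Fin 2 → ℂ) (d : (R → Fin 2) → ℂ)
    (hK : ∀ x j c, K (Function.update x (q j) c) = K x)
    (hk : ∀ x j c, k (Function.update x (q j) c) = k x)
    (hg : ∀ i x j c, g i (Function.update x (q j) c) = g i x)
    (he : ∀ i x j c, e i (Function.update x (q j) c) = e i x)
    (hd : ∀ x, d x = k x * ∏ j, e j x (x (q j))) :
    conjDiag q U U' d (fun x => K x * ∏ j, g j x (x (q j))) =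
      fun x => k x * K x * ∏ j, ∑ b, (U' j).1 (x (q j)) b *
        (e j x b * ∑ c, (U j).1 b c * g j x c) := by
  have h1 := locL_univ_prod q hq U K g hK hg
  have h2 : diag d (fun x => K x * ∏ j, ∑ b, (U j).1 (x (q j)) b * g j x b) =
      fun x => (k x * K x) * ∏ j, (fun j x a => e j x a * ∑ c, (U j).1 a c * g j x c) j x
        (x (q j)) := by
    funext x
    simp only [diag, hd, Finset.prod_mul_distrib]
    ring
  have h3 := locL_univ_prod q hq U' (fun x => k x * K x)
    (fun j x a => e j x a * ∑ c, (U j).1 a c * g j x c) (fun x j c => by rw [hK, hk])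
    (fun i x j c => by simp only [hg, he])
  change locL _ q U' (diag d (locL _ q U _)) = _
  rw [h1, h2]
  exact h3

/-- Bit flips controlled by the other qubits. -/
lemma conjDiag_hadamard {J : Type} [Fintype J] [DecidableEq J] (q : J → R)
    (hq : Function.Injective q) (K : (R → Fin 2) → ℂ) (g : J → (R → Fin 2) → Fin 2 → ℂ)
    (f : J → (R → Fin 2) → Fin 2) (d : (R → Fin 2) → ℂ)
    (hK : ∀ x j c, K (Function.update x (q j) c) = K x)
    (hg : ∀ i x j c, g i (Function.update x (q j) c) = g i x)
    (hf : ∀ i x j c, f i (Function.update x (q j) c) = f i x)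
    (hd : ∀ x, d x = ∏ j, bsign (x (q j)) (f j x)) :
    conjDiag q (fun _ => hadamard) (fun _ => hadamard) d (fun x => K x * ∏ j, g j x (x (q j))) =
      fun x => K x * ∏ j, g j x (x (q j) + f j x) := by
  rw [conjDiag_prod q hq _ _ K (fun _ => 1) g (fun j x a => bsign a (f j x)) d hK
    (fun _ _ _ => rfl) hg (fun i x j c => by rw [hf]) (fun x => by rw [hd, one_mul])]
  simp only [hadamard_sign_hadamard, one_mul]

end Simulation
end MFCircuit

namespace MFCircuit

/-! ### Renaming qubits. -/

section Relabel

variable {ι κ : Type} [DecidableEq ι] [DecidableEq κ] (e : ι ≃ κ)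

/-- A gate on renamed qubits. -/
def relabelGate : QGate ι → QGate κ
  | .single i U => .single (e i) U
  | .cnot c t h => .cnot (e c) (e t) (e.injective.ne h)

lemma support_relabelGate (g : QGate ι) :
    (relabelGate e g).support = g.support.map e.toEmbedding := by
  cases g <;> simp [relabelGate, QGate.support]

/-- A layer on renamed qubits. -/
def relabelLayer : QLayer ι → QLayer κ
  | .gates gs h => .gates (gs.map fun g => ⟨relabelGate e g.gate, fun rec =>
      g.cond (rec.map fun o => o ∘ e)⟩) (by
      rw [List.pairwise_map]
      refine h.imp fun {a b} hab => ?_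
      simpa only [support_relabelGate, Finset.disjoint_map] using hab)
  | .measure S => .measure (S.map e.toEmbedding)

lemma comp_update (x : ι → Fin 2) (i : ι) (b : Fin 2) :
    Function.update (x ∘ e.symm) (e i) b = Function.update x i b ∘ e.symm := by
  funext k
  by_cases h : k = e i
  · subst h; simp
  · have : e.symm k ≠ i := fun h' => h (by simp [← h'])
    simp [h, this]

lemma relabelGate_apply (g : QGate ι) (w : QState κ) :
    (fun x : ι → Fin 2 => (relabelGate e g).apply w (x ∘ e.symm)) =
      g.apply fun x => w (x ∘ e.symm) := by
  funext x
  cases g <;> simp [relabelGate, QGate.apply, comp_update]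

lemma branch_relabel (r : ℕ → κ → Fin 2) (C : MFCircuit ι) (rec : MeasRecord κ) (w : QState κ) :
    (fun x : ι → Fin 2 => branch r (C.map (relabelLayer e)) rec w (x ∘ e.symm)) =
      branch (fun k => r k ∘ e) C (rec.map fun o => o ∘ e) fun x => w (x ∘ e.symm) := by
  induction C generalizing rec w with
  | nil => rfl
  | cons l C ih =>
    cases l with
    | gates gs h =>
      rw [List.map_cons, relabelLayer, branch, branch, ih]
      congr 1
      clear h ih
      induction gs generalizing w with
      | nil => rfl
      | cons g gs ih =>
        rw [List.map_cons, List.foldl_cons, List.foldl_cons, ih]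
        congr 1
        unfold applyGate
        simp only
        split_ifs
        · exact relabelGate_apply e _ _
        · rfl
    | measure S =>
      rw [List.map_cons, relabelLayer, branch, branch, ih]
      congr 1
      · simp only [List.map_append, List.map_cons, List.map_nil, List.length_map]
        congr 2
        funext i
        simp [restrictOutcome]
      · funext x
        simp only [collapse, Function.comp_apply, List.length_map]
        refine if_congr ⟨fun h i hi => ?_, fun h k hk => ?_⟩ rfl rfl
        · simpa using h (e i) (Finset.mem_map_of_mem _ hi)
        · obtain ⟨i, hi, rfl⟩ := Finset.mem_map.1 hk
          simpa using h i hi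

end Relabel

/-! ### From a simulated operator to a preparing circuit. -/

section Preparation

/-- The state `ψ ⊗ |0…0⟩` of a register with `n` distinguished qubits. -/
def tensorZero {n : ℕ} {Y : Type} [Fintype Y] (ψ : (Fin n → Fin 2) → ℂ) : QState (Fin n ⊕ Y) :=
  fun y => if ∀ j, y (.inr j) = 0 then ψ fun i => y (.inl i) else 0

lemma extend_zeroState {R V : Type} [Fintype R] [Fintype V] [DecidableEq R] [DecidableEq V] :
    (extend zeroState : QState (Ext R V)) = zeroState := by
  funext y
  simp only [extend, ParityChecks.prod_ite_eq_ite_forall, zeroState, mul_ite, mul_one, mul_zero,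
    ← ite_and, Sum.forall]
  congr 1
  rw [eq_iff_iff]
  tauto

lemma exists_prepares {n N dep meas : ℕ} {Y : Type} [Fintype Y] [DecidableEq Y]
    (ψ : EuclideanSpace ℂ (Fin n → Fin 2)) (T : QState (Fin n ⊕ Y) → QState (Fin n ⊕ Y))
    (hT : Sim N dep meas T) (a : ℂ) (h : T zeroState = a • tensorZero ψ) :
    ∃ C : MFCircuit (Fin n ⊕ Fin (Fintype.card Y + 4 * N)),
      C.Prepares ψ ∧ depth C ≤ dep ∧ measLayers C ≤ meas := by
  obtain ⟨C, h1, h2, h3⟩ := hT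
  have e₀ : (Y ⊕ (Fin N ⊕ Fin N)) ⊕ (Fin N ⊕ Fin N) ≃ Fin (Fintype.card Y + 4 * N) :=
    Fintype.equivFinOfCardEq (by simp; ring)
  set e : Ext (Fin n ⊕ Y) (Fin N ⊕ Fin N) ≃ Fin n ⊕ Fin (Fintype.card Y + 4 * N) :=
    ((Equiv.sumCongr (Equiv.sumAssoc _ _ _) (Equiv.refl _)).trans (Equiv.sumAssoc _ _ _)).trans
      (Equiv.sumCongr (Equiv.refl _) e₀) with he
  refine ⟨C.map (relabelLayer e), fun r => ?_, by simpa [depth] using h1, ?_⟩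
  · obtain ⟨c, hc⟩ := h3 (fun k => r k ∘ e) [] zeroState
    refine ⟨c * a, ?_⟩
    have hb := branch_relabel e r C [] zeroState
    have hz : (fun x => zeroState (x ∘ e.symm) : QState (Ext (Fin n ⊕ Y) (Fin N ⊕ Fin N))) =
        extend zeroState := by
      rw [extend_zeroState]
      funext x
      simp only [zeroState, Function.comp_apply]
      congr 1
      rw [eq_iff_iff]
      exact ⟨fun hx i => by simpa using hx (e i), fun hx i => hx _⟩
    rw [hz, List.map_nil, hc, h, extend_smul, smul_smul] at hb
    funext y
    have hy := congrFun hb (y ∘ e)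
    simp only [Function.comp_assoc, Equiv.self_comp_symm, Function.comp_id] at hy
    rw [hy]
    simp only [Pi.smul_apply]
    congr 1
    have he1 : ∀ i, e (.inl (.inl (.inl i))) = .inl i := fun i => rfl
    have he2 : ∀ j, e (.inl (.inl (.inr j))) = .inr (e₀ (.inl (.inl j))) := fun i => rfl
    have he3 : ∀ j, e (.inl (.inr j)) = .inr (e₀ (.inl (.inr j))) := fun i => rfl
    have he4 : ∀ j, e (.inr j) = .inr (e₀ (.inr j)) := fun i => rfl
    simp only [extend, ParityChecks.prod_ite_eq_ite_forall, tensorZero, withAncillas,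
      Function.comp_apply, he1, he2, he3, he4]
    have hall : (∀ j, y (.inr j) = 0) ↔ (∀ j, y (.inr (e₀ (.inl (.inl j)))) = 0) ∧
        (∀ j, y (.inr (e₀ (.inl (.inr j)))) = 0) ∧ ∀ j, y (.inr (e₀ (.inr j))) = 0 := by
      rw [← e₀.forall_congr_right, Sum.forall, Sum.forall, and_assoc]
    by_cases hA : ∀ j, y (.inr j) = 0
    · rw [if_pos hA, if_pos (hall.1 hA).1, if_pos (hall.1 hA).2.1, if_pos (hall.1 hA).2.2]
      simp
    · rw [if_neg hA]
      by_cases hA1 : ∀ j, y (.inr (e₀ (.inl (.inl j)))) = 0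
      · by_cases hA2 : ∀ j, y (.inr (e₀ (.inl (.inr j)))) = 0
        · rw [if_neg (fun hA3 => hA (hall.2 ⟨hA1, hA2, hA3⟩)), mul_zero]
        · rw [if_neg hA2, mul_zero, zero_mul]
      · rw [if_neg hA1, zero_mul, zero_mul]
  · have : measLayers (C.map (relabelLayer e)) = measLayers C := by
      rw [measLayers, List.countP_map, measLayers]
      congr 1
      funext l
      cases l <;> rfl
    rw [this]
    exact h2

end Preparation
end MFCircuit

namespace MFCircuit

/-! ### The binary tree, its qubits, and exact mismatch counters. -/

section Tree

/-- The nodes of depth less than `m` of the binary tree, as bit strings. -/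
abbrev Node (m : ℕ) : Type := Σ i : Fin m, (Fin i → Fin 2)

lemma card_node_add_one (m : ℕ) : Fintype.card (Node m) + 1 = 2 ^ m := by
  rw [Fintype.card_sigma]
  simp only [Fintype.card_fun, Fintype.card_fin]
  induction m with
  | zero => simp
  | succ m ih =>
    rw [Fin.sum_univ_castSucc, pow_succ]
    simp only [Fin.val_castSucc, Fin.val_last]
    omega

variable {n e : ℕ}

/-- The prefix of length `j` of a bit string. -/
def Node.pre (v : Node (n + 1)) (j : Fin v.1) : Node n :=
  ⟨⟨j, by omega⟩, fun t => v.2 ⟨t, t.2.trans j.2⟩⟩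

/-- A bit string of length at most `e`, as one of length at most `n`. -/
def Node.up (he : e ≤ n) (u : Node (e + 1)) : Node (n + 1) := ⟨⟨u.1, by omega⟩, u.2⟩

/-- The prefix of length at most `e`. -/
def Node.trunc (e : ℕ) (v : Node (n + 1)) : Node (e + 1) :=
  ⟨⟨min v.1 e, by omega⟩, fun t => v.2 ⟨t, by have := t.2; simp only at this; omega⟩⟩

/-- The qubits: the `n` qubits of the state to be prepared, a qubit for each inner node of the
tree, counters for the nodes of depth at most `e`, and two registers for path indicators. -/
abbrev Reg (n e L : ℕ) : Type :=
  Fin n ⊕ (Node n ⊕ ((Node (e + 1) × Fin L) ⊕ (Node (e + 1) ⊕ Node (n + 1))))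

variable {L : ℕ}

def qOut (i : Fin n) : Reg n e L := .inl i
def qNode (w : Node n) : Reg n e L := .inr (.inl w)
def qCount (u : Node (e + 1) × Fin L) : Reg n e L := .inr (.inr (.inl u))
def qTop (u : Node (e + 1)) : Reg n e L := .inr (.inr (.inr (.inl u)))
def qPath (v : Node (n + 1)) : Reg n e L := .inr (.inr (.inr (.inr v)))

lemma qOut_injective : Function.Injective (qOut : _ → Reg n e L) := fun _ _ h => by
  simpa [qOut] using h
lemma qNode_injective : Function.Injective (qNode : _ → Reg n e L) := fun _ _ h => by
  simpa [qNode] using h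
lemma qCount_injective : Function.Injective (qCount : _ → Reg n e L) := fun _ _ h => by
  simpa [qCount] using h
lemma qTop_injective : Function.Injective (qTop : _ → Reg n e L) := fun _ _ h => by
  simpa [qTop] using h
lemma qPath_injective : Function.Injective (qPath : _ → Reg n e L) := fun _ _ h => by
  simpa [qPath] using h

instance : Nonempty (Reg n e L) := ⟨qPath ⟨0, Fin.elim0⟩⟩

variable (s : Node n → Reg n e L)

/-- The bits read from the source `s` lead to the node `v`. -/
def IsPath (y : Reg n e L → Fin 2) (v : Node (n + 1)) : Prop :=
  ∀ j : Fin v.1, y (s (v.pre j)) = v.2 j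

instance (y : Reg n e L → Fin 2) (v : Node (n + 1)) : Decidable (IsPath s y v) :=
  inferInstanceAs (Decidable (∀ j : Fin v.1, y (s (v.pre j)) = v.2 j))

/-- The bits read from the source `s` agree with `v` from position `e` on. -/
def IsTail (y : Reg n e L → Fin 2) (v : Node (n + 1)) : Prop :=
  ∀ j : Fin v.1, e ≤ j.val → y (s (v.pre j)) = v.2 j

instance (y : Reg n e L → Fin 2) (v : Node (n + 1)) : Decidable (IsTail s y v) :=
  inferInstanceAs (Decidable (∀ j : Fin v.1, e ≤ j.val → y (s (v.pre j)) = v.2 j))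

lemma isPath_iff (he : e ≤ n) (y : Reg n e L → Fin 2) (v : Node (n + 1)) :
    IsPath s y v ↔ IsPath s y ((v.trunc e).up he) ∧ IsTail s y v := by
  constructor
  · intro h
    refine ⟨fun j => ?_, fun j _ => h j⟩
    have hj : j.val < min v.1.val e := j.2
    exact h ⟨j, by omega⟩
  · rintro ⟨h1, h2⟩ j
    by_cases hj : e ≤ j.val
    · exact h2 j hj
    · exact h1 ⟨j.val, lt_min j.2 (by omega)⟩

/-- The number of bits read from the source that differ from those of `v`. -/
def misses (y : Reg n e L → Fin 2) (v : Node (n + 1)) : ℕ :=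
  (Finset.univ.filter fun j : Fin v.1 => y (s (v.pre j)) = v.2 j + 1).card

lemma fin_two_eq_add_one (a b : Fin 2) : a = b + 1 ↔ a ≠ b := by
  fin_cases a <;> fin_cases b <;> simp

lemma misses_eq_zero_iff (y : Reg n e L → Fin 2) (v : Node (n + 1)) :
    misses s y v = 0 ↔ IsPath s y v := by
  simp [misses, Finset.card_eq_zero, Finset.filter_eq_empty_iff, fin_two_eq_add_one, IsPath]

lemma misses_le (y : Reg n e L → Fin 2) (v : Node (n + 1)) : misses s y v ≤ n := by
  refine (Finset.card_le_univ _).trans ?_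
  rw [Fintype.card_fin]
  omega

/-- The amplitude at `a` of a counter that starts in `|0⟩`. -/
noncomputable def countAmp (l : ℕ) (m : ℕ) (a : Fin 2) : ℂ :=
  ∑ b, hadamard.1 a b * ((if b = 1 then
    Complex.exp (Complex.I * (2 * Real.pi / 2 ^ (l + 1) : ℝ)) ^ m else 1) * ∑ c, hadamard.1 b c * if c = 0 then 1 else 0)

lemma countAmp_zero (l : ℕ) (a : Fin 2) : countAmp l 0 a = if a = 0 then 1 else 0 := by
  have := hadamard_sign_hadamard (fun c => if c = 0 then 1 else 0) a 0
  simp only [add_zero, bsign_zero_right] at this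
  simpa [countAmp] using this

/-- The accumulated phase is an odd multiple of `π`, so between the Hadamard gates it is a full bit
flip and the counter is exactly `|1⟩`. -/
lemma countAmp_odd (l k : ℕ) : countAmp l (2 ^ l * (2 * k + 1)) 0 = 0 := by
  have h1 : Complex.exp (Complex.I * (2 * Real.pi / 2 ^ (l + 1) : ℝ)) ^ (2 ^ l * (2 * k + 1)) =
      -1 := by
    rw [← Complex.exp_nat_mul]
    have : ((2 ^ l * (2 * k + 1) : ℕ) : ℂ) * (Complex.I * (2 * Real.pi / 2 ^ (l + 1) : ℝ)) =
        Real.pi * Complex.I + k * (2 * Real.pi * Complex.I) := by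
      push_cast
      rw [pow_succ]
      field_simp
      ring
    rw [this, Complex.exp_add, Complex.exp_nat_mul_two_pi_mul_I, mul_one, Complex.exp_pi_mul_I]
  have h2 := hadamard_sign_hadamard (fun c => if c = 0 then 1 else 0) 0 1
  rw [countAmp, h1]
  simpa [bsign] using h2

/-- The amplitude of the contents of the counters. -/
noncomputable def countersAmp (he : e ≤ n) (y : Reg n e L → Fin 2) : ℂ :=
  ∏ u : Node (e + 1) × Fin L, countAmp u.2 (misses s y (u.1.up he)) (y (qCount u))

/-- A nonzero count is `2 ^ l` times an odd number, and then counter `l` is surely 1; a count of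
zero leaves all counters at 0. The other counters may be in superposition, which is harmless: only
the test for all zeros is used. The bound `n < 2 ^ L` ensures that counter `l` exists. -/
lemma counters_eq_zero_iff (he : e ≤ n) (hL : n < 2 ^ L) (y : Reg n e L → Fin 2)
    (h : countersAmp s he y ≠ 0) (u : Node (e + 1)) :
    (∀ l, y (qCount (u, l)) = 0) ↔ IsPath s y (u.up he) := by
  have h' : ∀ l : Fin L, countAmp l (misses s y (u.up he)) (y (qCount (u, l))) ≠ 0 := fun l =>
    Finset.prod_ne_zero_iff.1 h (u, l) (Finset.mem_univ _)
  rw [← misses_eq_zero_iff]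
  constructor
  · intro hl
    by_contra hm
    obtain ⟨l, k, hk, hmk⟩ := Nat.exists_eq_two_pow_mul_odd hm
    obtain ⟨k, rfl⟩ := hk
    have hlt : 2 ^ l < 2 ^ L := by
      have h1 := misses_le s y (u.up he)
      have : 2 ^ l ≤ 2 ^ l * (2 * k + 1) := Nat.le_mul_of_pos_right _ (by omega)
      omega
    have := h' ⟨l, (Nat.pow_lt_pow_iff_right (by norm_num)).1 hlt⟩
    rw [hl, hmk] at this
    exact this (countAmp_odd l k)
  · intro hm l
    by_contra hl
    have := h' l
    rw [hm, countAmp_zero, if_neg hl] at this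
    exact this rfl

/-- The indicator of a proposition. -/
def bit (p : Prop) [Decidable p] : Fin 2 := if p then 1 else 0

lemma bit_congr {p q : Prop} [Decidable p] [Decidable q] (h : p ↔ q) : bit p = bit q := by
  simp [bit, h]

lemma bit_eq_one {p : Prop} [Decidable p] : bit p = 1 ↔ p := by
  by_cases h : p <;> simp [bit, h]

/-- The phases of the counters. -/
noncomputable def countPhase (he : e ≤ n) (y : Reg n e L → Fin 2) : ℂ :=
  ∏ u : Node (e + 1) × Fin L, ∏ j : Fin (u.1.up he).1,
    if y (qCount u) = 1 ∧ y (s ((u.1.up he).pre j)) = (u.1.up he).2 j + 1 then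
      Complex.exp (Complex.I * (2 * Real.pi / 2 ^ (u.2.val + 1) : ℝ)) else 1

/-- The phases that set the indicators of the nodes of depth at most `e`. -/
noncomputable def topPhase (y : Reg n e L → Fin 2) : ℂ :=
  ∏ u : Node (e + 1), bsign (y (qTop u)) (bit (∀ l, y (qCount (u, l)) = 0))

/-- The phases that set the path indicators. -/
noncomputable def pathPhase (y : Reg n e L → Fin 2) : ℂ :=
  ∏ v : Node (n + 1), bsign (y (qPath v)) (bit (y (qTop (v.trunc e)) = 1 ∧ IsTail s y v))

/-- The computation of the path indicators. -/
noncomputable def computePaths (he : e ≤ n) : QState (Reg n e L) → QState (Reg n e L) :=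
  conjDiag qPath (fun _ => hadamard) (fun _ => hadamard) (pathPhase s) ∘
    conjDiag qTop (fun _ => hadamard) (fun _ => hadamard) topPhase ∘
      conjDiag qCount (fun _ => hadamard) (fun _ => hadamard) (countPhase s he)

/-- The amplitude of the workspace after the computation of the path indicators. -/
noncomputable def workAmp (he : e ≤ n) (y : Reg n e L → Fin 2) : ℂ :=
  countersAmp s he y * (∏ u, if y (qTop u) = bit (IsPath s y (u.up he)) then 1 else 0) *
    ∏ v, if y (qPath v) = bit (IsPath s y v) then 1 else 0

/-- The amplitude of the workspace `|0…0⟩`. -/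
def zeroAmp (y : Reg n e L → Fin 2) : ℂ :=
  (∏ u, if y (qCount u) = 0 then 1 else 0) * (∏ u, if y (qTop u) = 0 then 1 else 0) *
    ∏ v, if y (qPath v) = 0 then 1 else 0

end Tree
end MFCircuit

namespace MFCircuit

/-! ### Correctness of the path indicators. -/

section ComputePaths

variable {n e L : ℕ} (s : Node n → Reg n e L)

/-- The function `K` does not depend on the workspace. -/
def WorkFree {α : Sort*} (K : (Reg n e L → Fin 2) → α) : Prop :=
  ∀ x k c, K (Function.update x (.inr (.inr k)) c) = K x

/-- The source consists of qubits outside of the workspace. -/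
def IsSource : Prop := ∀ w k, s w ≠ .inr (.inr k)

variable {s}

lemma IsSource.update (hs : IsSource s) (x : Reg n e L → Fin 2) (k) (c : Fin 2) (w : Node n) :
    Function.update x (.inr (.inr k)) c (s w) = x (s w) :=
  Function.update_of_ne (hs w k) _ _

lemma IsSource.isPath (hs : IsSource s) (x : Reg n e L → Fin 2) (k) (c : Fin 2)
    (v : Node (n + 1)) : IsPath s (Function.update x (.inr (.inr k)) c) v ↔ IsPath s x v := by
  simp only [IsPath, hs.update]

lemma IsSource.isTail (hs : IsSource s) (x : Reg n e L → Fin 2) (k) (c : Fin 2)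
    (v : Node (n + 1)) : IsTail s (Function.update x (.inr (.inr k)) c) v ↔ IsTail s x v := by
  simp only [IsTail, hs.update]

lemma IsSource.misses (hs : IsSource s) (x : Reg n e L → Fin 2) (k) (c : Fin 2)
    (v : Node (n + 1)) : misses s (Function.update x (.inr (.inr k)) c) v = misses s x v := by
  simp only [MFCircuit.misses, hs.update]

/-- Every mismatch contributes the same phase to a counter, so the product over the path is a power
with exponent the number of misses. -/
lemma compute_counters (hs : IsSource s) (he : e ≤ n) (K : (Reg n e L → Fin 2) → ℂ)
    (hK : WorkFree K) :
    conjDiag qCount (fun _ => hadamard) (fun _ => hadamard) (countPhase s he)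
      (fun y => K y * zeroAmp y) = fun y => (K y * countersAmp s he y *
        ∏ v, if y (qPath v) = 0 then 1 else 0) * ∏ u, if y (qTop u) = 0 then 1 else 0 := by
  have h := conjDiag_prod (qCount : _ → Reg n e L) qCount_injective (fun _ => hadamard)
    (fun _ => hadamard)
    (fun y => K y * (∏ u, if y (qTop u) = 0 then 1 else 0) * ∏ v, if y (qPath v) = 0 then 1 else 0)
    (fun _ => 1) (fun _ _ a => if a = 0 then 1 else 0)
    (fun u y b => if b = 1 then Complex.exp (Complex.I * (2 * Real.pi / 2 ^ (u.2.val + 1) : ℝ)) ^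
      MFCircuit.misses s y (u.1.up he) else 1) (countPhase s he)
    (fun x j c => by rw [qCount, hK]; rfl) (fun _ _ _ => rfl) (fun _ _ _ _ => rfl)
    (fun i x j c => by rw [qCount, hs.misses])
    (fun x => by
      rw [countPhase, one_mul]
      refine Finset.prod_congr rfl fun u _ => ?_
      by_cases hx : x (qCount u) = 1
      · simp only [hx, true_and, if_true]
        rw [← Finset.prod_filter, Finset.prod_const]
        rfl
      · simp [hx])
  convert h using 1
  · congr 1
    funext y
    rw [zeroAmp]
    ring
  · funext y
    rw [one_mul, countersAmp]
    simp only [countAmp]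
    ring

lemma compute_tops (hs : IsSource s) (he : e ≤ n) (hL : n < 2 ^ L) (K : (Reg n e L → Fin 2) → ℂ)
    (hK : WorkFree K) :
    conjDiag qTop (fun _ => hadamard) (fun _ => hadamard) topPhase
      (fun y : Reg n e L → Fin 2 => (K y * countersAmp s he y *
        ∏ v, if y (qPath v) = 0 then 1 else 0) * ∏ u, if y (qTop u) = 0 then 1 else 0) =
      fun y => (K y * countersAmp s he y * ∏ u, if y (qTop u) = bit (IsPath s y (u.up he)) then
        1 else 0) * ∏ v, if y (qPath v) = 0 then 1 else 0 := by
  have h := conjDiag_hadamard (qTop : _ → Reg n e L) qTop_injective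
    (fun y => K y * countersAmp s he y * ∏ v, if y (qPath v) = 0 then 1 else 0)
    (fun _ _ a => if a = 0 then 1 else 0) (fun u y => bit (∀ l, y (qCount (u, l)) = 0)) topPhase
    (fun x j c => by
      rw [qTop, hK]
      simp only [countersAmp, hs.misses]
      rfl) (fun _ _ _ _ => rfl) (fun _ _ _ _ => rfl) (fun x => rfl)
  rw [h]
  funext y
  -- The counters decide the path condition only on the support of the state, which is all that
  -- matters.
  by_cases h0 : countersAmp s he y = 0
  · simp [h0]
  · rw [mul_right_comm]
    congr 2
    refine Finset.prod_congr rfl fun u _ => ?_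
    rw [bit_congr (counters_eq_zero_iff s he hL y h0 u)]
    refine if_congr ?_ rfl rfl
    omega

lemma compute_paths (hs : IsSource s) (he : e ≤ n) (K : (Reg n e L → Fin 2) → ℂ)
    (hK : WorkFree K) :
    conjDiag qPath (fun _ => hadamard) (fun _ => hadamard) (pathPhase s)
      (fun y => (K y * countersAmp s he y * ∏ u, if y (qTop u) = bit (IsPath s y (u.up he)) then
        1 else 0) * ∏ v, if y (qPath v) = 0 then 1 else 0) = fun y => K y * workAmp s he y := by
  have h := conjDiag_hadamard (qPath : _ → Reg n e L) qPath_injective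
    (fun y => K y * countersAmp s he y * ∏ u, if y (qTop u) = bit (IsPath s y (u.up he)) then
        1 else 0)
    (fun _ _ a => if a = 0 then 1 else 0)
    (fun v y => bit (y (qTop (v.trunc e)) = 1 ∧ IsTail s y v)) (pathPhase s)
    (fun x j c => by
      rw [qPath, hK]
      simp only [countersAmp, hs.misses, bit_congr (hs.isPath _ _ _ _)]
      rfl) (fun _ _ _ _ => rfl)
    (fun i x j c => by
      rw [qPath]
      simp only [bit_congr (and_congr_right' (hs.isTail _ _ _ _))]
      rfl) (fun x => rfl)
  rw [h]
  funext y
  rw [workAmp, ← mul_assoc, ← mul_assoc]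
  by_cases h0 : ∏ u, (if y (qTop u) = bit (IsPath s y (u.up he)) then (1 : ℂ) else 0) = 0
  · simp [h0]
  · congr 1
    refine Finset.prod_congr rfl fun v _ => ?_
    have h1 : y (qTop (v.trunc e)) = bit (IsPath s y ((v.trunc e).up he)) := by
      by_contra hc
      exact Finset.prod_ne_zero_iff.1 h0 (v.trunc e) (Finset.mem_univ _) (if_neg hc)
    have h2 : (y (qTop (v.trunc e)) = 1 ∧ IsTail s y v) ↔ IsPath s y v := by
      rw [h1, bit_eq_one, ← isPath_iff]
    rw [bit_congr h2]
    refine if_congr ?_ rfl rfl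
    omega

/-- Since `K` is arbitrary off the workspace, the same equation read backwards shows that a left
inverse cleans the workspace even after `K` has changed. -/
lemma computePaths_apply (hs : IsSource s) (he : e ≤ n) (hL : n < 2 ^ L)
    (K : (Reg n e L → Fin 2) → ℂ) (hK : WorkFree K) :
    computePaths s he (fun y => K y * zeroAmp y) = fun y => K y * workAmp s he y := by
  rw [computePaths, Function.comp_apply, Function.comp_apply, compute_counters hs he K hK,
    compute_tops hs he hL K hK, compute_paths hs he K hK]

end ComputePaths

/-! ### Length of the phase products for the path indicators. -/

section Cost

variable {n e L : ℕ} (s : Node n → Reg n e L)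

/-- The sign is a phase `π` controlled by the target qubit together with the literals, whence
`l.length + 1`. -/
lemma hasPhase_bsign_and {R : Type} [Nonempty R] (l : List (R × Fin 2)) (i : R) (N : ℕ)
    (hN : 2 ^ (l.length + 1) * (l.length + 1) ≤ N) {p : (R → Fin 2) → Prop}
    [∀ x, Decidable (p x)] (hp : ∀ x, p x ↔ ∀ q ∈ l, x q.1 = q.2) :
    HasPhase N fun x => bsign (x i) (bit (p x)) := by
  convert (hasPhase_and ((i, 1) :: l) Real.pi).mono hN using 2 with x
  rw [mul_comm, Complex.exp_pi_mul_I, bsign]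
  refine if_congr ?_ rfl rfl
  rw [bit_eq_one, hp, List.forall_mem_cons]

/-- Each factor is a phase controlled by two literals, of length `2 ^ 2 * 2 = 8`. -/
lemma hasPhase_countPhase (he : e ≤ n) :
    HasPhase (2 ^ (e + 1) * L * (n * 8)) (countPhase s he) := by
  have h : HasPhase (Fintype.card (Node (e + 1) × Fin L) * (n * 8)) (countPhase s he) := by
    refine HasPhase.prod _ fun u _ => ?_
    refine (HasPhase.prod (N := 8) (Finset.univ : Finset (Fin (u.1.up he).1)) fun j _ => ?_).mono ?_
    · convert hasPhase_and [(qCount u, 1), (s ((u.1.up he).pre j), (u.1.up he).2 j + 1)]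
        (2 * Real.pi / 2 ^ (u.2.val + 1)) using 2 with y
      · simp
      · simp
    · rw [Finset.card_univ, Fintype.card_fin]
      exact Nat.mul_le_mul_right _ (by omega)
  refine h.mono (Nat.mul_le_mul_right _ ?_)
  rw [Fintype.card_prod, Fintype.card_fin]
  have := card_node_add_one (e + 1)
  exact Nat.mul_le_mul_right _ (by omega)

lemma hasPhase_topPhase :
    HasPhase (2 ^ (e + 1) * (2 ^ (L + 1) * (L + 1))) (topPhase : (Reg n e L → Fin 2) → ℂ) := by
  refine (HasPhase.prod (N := 2 ^ (L + 1) * (L + 1)) Finset.univ fun u _ => ?_).mono ?_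
  · refine hasPhase_bsign_and ((List.finRange L).map fun l => (qCount (u, l), 0)) _ _ ?_ fun x => ?_
    · simp
    · simp
  · have := card_node_add_one (e + 1)
    exact Nat.mul_le_mul_right _ (by rw [Finset.card_univ]; omega)

/-- Besides at most `k` tail bits, each conjunction contains the indicator of the truncated node and
the target: `k + 2` literals. -/
lemma hasPhase_pathPhase (k : ℕ) (hk : n ≤ e + k) :
    HasPhase (2 ^ (n + 1) * (2 ^ (k + 2) * (k + 2))) (pathPhase s) := by
  refine (HasPhase.prod (N := 2 ^ (k + 2) * (k + 2)) Finset.univ fun v _ => ?_).mono ?_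
  · set l : List (Fin v.1) := (List.finRange v.1).filter fun j => e ≤ j.val with hl
    have hlen : l.length ≤ k := by
      have hn : (l.map fun j => j.val).Nodup :=
        ((List.nodup_finRange _).filter _).map Fin.val_injective
      have hsub : (l.map fun j => j.val).toFinset ⊆ Finset.Ico e n := by
        intro t ht
        simp only [hl, List.mem_toFinset, List.mem_map, List.mem_filter, decide_eq_true_eq] at ht
        obtain ⟨j, ⟨_, hj⟩, rfl⟩ := ht
        exact Finset.mem_Ico.2 ⟨hj, by omega⟩
      have := Finset.card_le_card hsub
      rw [List.toFinset_card_of_nodup hn, List.length_map, Nat.card_Ico] at this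
      omega
    refine hasPhase_bsign_and ((qTop (v.trunc e), 1) :: l.map fun j => (s (v.pre j), v.2 j)) _ _ ?_
      fun x => ?_
    · simp only [List.length_cons, List.length_map]
      exact Nat.mul_le_mul (Nat.pow_le_pow_right (by norm_num) (by omega)) (by omega)
    · simp [hl, IsTail]
  · have := card_node_add_one (n + 1)
    exact Nat.mul_le_mul_right _ (by rw [Finset.card_univ]; omega)

lemma revSim_computePaths (he : e ≤ n) (N k : ℕ) (hk : n ≤ e + k)
    (h1 : 2 ^ (e + 1) * L * (n * 8) ≤ N) (h2 : 2 ^ (e + 1) * (2 ^ (L + 1) * (L + 1)) ≤ N)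
    (h3 : 2 ^ (n + 1) * (2 ^ (k + 2) * (k + 2)) ≤ N) : RevSim N 39 6 (computePaths s he) :=
  (revSim_conjDiag _ qPath_injective _ _ ((hasPhase_pathPhase s k hk).mono h3)).comp
    ((revSim_conjDiag _ qTop_injective _ _ (hasPhase_topPhase.mono h2)).comp
      (revSim_conjDiag _ qCount_injective _ _ ((hasPhase_countPhase s he).mono h1)))

end Cost
end MFCircuit

namespace MFCircuit

/-! ### Conditional amplitudes as angles, and the reflection that resets a node. -/

section Angles

/-- The amplitudes of the real qubit state of angle `t`. -/
noncomputable def angleAmp (t : ℝ) (c : Fin 2) : ℝ := if c = 0 then Real.cos t else Real.sin t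

lemma exists_angle (a b : ℝ) : ∃ t, ∀ c : Fin 2,
    (if c = 0 then a else b) = Real.sqrt (a ^ 2 + b ^ 2) * angleAmp t c := by
  refine ⟨Complex.arg ⟨a, b⟩, fun c => ?_⟩
  have h : Real.sqrt (a ^ 2 + b ^ 2) = ‖(⟨a, b⟩ : ℂ)‖ := by
    rw [Complex.norm_def, Complex.normSq_mk]
    ring_nf
  rw [h, angleAmp]
  split_ifs
  · exact (Complex.norm_mul_cos_arg ⟨a, b⟩).symm
  · exact (Complex.norm_mul_sin_arg ⟨a, b⟩).symm

/-- A real unit vector with nonnegative entries as a product of conditional amplitudes. -/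
lemma exists_angles (n : ℕ) (f : (Fin n → Fin 2) → ℝ) (h0 : ∀ x, 0 ≤ f x)
    (h1 : ∑ x, f x ^ 2 = 1) : ∃ t : ∀ i : ℕ, (Fin i → Fin 2) → ℝ,
      ∀ x, f x = ∏ i : Fin n, angleAmp (t i fun j => x ⟨j, j.2.trans i.2⟩) (x i) := by
  induction n with
  | zero =>
    refine ⟨fun _ _ => 0, fun x => ?_⟩
    rw [Fintype.sum_eq_single x (fun y hy => absurd (Subsingleton.elim y x) hy)] at h1
    rw [Finset.univ_eq_empty, Finset.prod_empty]
    nlinarith [h0 x]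
  | succ n ih =>
    set sn : (Fin n → Fin 2) → Fin 2 → Fin (n + 1) → Fin 2 :=
      fun v c => Fin.snoc (α := fun _ => Fin 2) v c with hsn
    -- The root of the marginal distribution of the first `n` bits is again a nonnegative unit
    -- vector; the last bit contributes its conditional angle.
    set g : (Fin n → Fin 2) → ℝ := fun v => Real.sqrt (f (sn v 0) ^ 2 + f (sn v 1) ^ 2) with hg
    obtain ⟨t, ht⟩ := ih g (fun v => Real.sqrt_nonneg _) (by
      simp only [hg]
      rw [← h1, ← (Fin.snocEquiv fun _ => Fin 2).sum_comp, Fintype.sum_prod_type, Fin.sum_univ_two,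
        ← Finset.sum_add_distrib]
      refine Finset.sum_congr rfl fun v _ => ?_
      rw [Real.sq_sqrt (by positivity)]
      rfl)
    choose T hT using fun v => exists_angle (f (sn v 0)) (f (sn v 1))
    refine ⟨Function.update t n T, fun x => ?_⟩
    have hx : x = sn (fun j => x j.castSucc) (x (Fin.last n)) := (Fin.snoc_init_self x).symm
    have h2 : f x = g (fun j => x j.castSucc) * angleAmp (T fun j => x j.castSucc)
        (x (Fin.last n)) := by
      rw [hg, ← hT]
      conv_lhs => rw [hx]
      have : x (Fin.last n) = 0 ∨ x (Fin.last n) = 1 := by omega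
      rcases this with h | h <;> simp [h]
    rw [h2, ht, Fin.prod_univ_castSucc]
    congr 1
    · refine Finset.prod_congr rfl fun i _ => ?_
      simp only [Fin.val_castSucc]
      rw [Function.update_of_ne i.2.ne]
      rfl
    · simp only [Fin.val_last, Function.update_self]
      rfl

lemma rotation_two_mul (t : ℝ) (a : Fin 2) : (rotation (2 * t)).1 a 0 = angleAmp t a := by
  have : 2 * t / 2 = t := by ring
  fin_cases a <;> simp [rotation, angleAmp]

lemma rotation_neg (t : ℝ) (g : Fin 2 → ℂ) (a : Fin 2) :
    ∑ b, (rotation t).1 a b * (bsign b 0 * ∑ c, (rotation (-t)).1 b c * g c) = g a := by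
  have h : (Real.cos (t / 2) : ℂ) ^ 2 + Real.sin (t / 2) ^ 2 = 1 := by
    exact_mod_cast Real.cos_sq_add_sin_sq (t / 2)
  have h2 : -t / 2 = -(t / 2) := by ring
  fin_cases a <;>
    simp only [rotation, Fin.sum_univ_two, h2, Real.cos_neg, Real.sin_neg, Matrix.of_apply,
      Matrix.cons_val', Matrix.cons_val_zero, Matrix.cons_val_one, Matrix.cons_val_fin_one,
      Fin.zero_eta, Fin.mk_one, bsign_zero_right, Complex.ofReal_neg]
  · linear_combination g 0 * h
  · linear_combination g 1 * h

/-- The conjugated `Z` is the reflection about the axis of angle `t / 2`, which exchanges the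
directions `t` and `0`. Without the sign the rotations cancel (`rotation_neg`), so the reflection
can be switched on by a sign alone. -/
lemma rotation_reflect (t : ℝ) (a : Fin 2) :
    ∑ b, (rotation t).1 a b * (bsign b 1 * ∑ c, (rotation (-t)).1 b c * (angleAmp t c : ℂ)) =
      if a = 0 then 1 else 0 := by
  have h : (Real.cos (t / 2) : ℂ) ^ 2 + Real.sin (t / 2) ^ 2 = 1 := by
    exact_mod_cast Real.cos_sq_add_sin_sq (t / 2)
  have hc : (Real.cos t : ℂ) = Real.cos (t / 2) ^ 2 - Real.sin (t / 2) ^ 2 := by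
    have := Real.cos_two_mul' (t / 2)
    rw [mul_div_cancel₀ _ two_ne_zero] at this
    exact_mod_cast this
  have hs : (Real.sin t : ℂ) = 2 * Real.sin (t / 2) * Real.cos (t / 2) := by
    have := Real.sin_two_mul (t / 2)
    rw [mul_div_cancel₀ _ two_ne_zero] at this
    exact_mod_cast this
  have h2 : -t / 2 = -(t / 2) := by ring
  have e0 : ((angleAmp t 0 : ℝ) : ℂ) = Real.cos t := by simp [angleAmp]
  have e1 : ((angleAmp t 1 : ℝ) : ℂ) = Real.sin t := by simp [angleAmp]
  have b0 : bsign 0 1 = 1 := by simp [bsign]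
  have b1 : bsign 1 1 = -1 := by simp [bsign]
  set C : ℂ := ((Real.cos (t / 2) : ℝ) : ℂ)
  set S : ℂ := ((Real.sin (t / 2) : ℝ) : ℂ)
  fin_cases a <;>
    simp only [rotation, Fin.sum_univ_two, h2, Real.cos_neg, Real.sin_neg, Matrix.of_apply,
      Matrix.cons_val', Matrix.cons_val_zero, Matrix.cons_val_one, Matrix.cons_val_fin_one,
      Fin.zero_eta, Fin.mk_one, Complex.ofReal_neg, e0, e1, b0, b1, hc, hs, if_true, one_ne_zero,
      if_false]
  · linear_combination (C ^ 2 + S ^ 2 + 1) * h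
  · ring

end Angles

/-! ### Following the node bits to a leaf. -/

section Leaf

variable {n : ℕ}

/-- The leaf that is reached by following the bits at the nodes. -/
def leafBit (b : Node n → Fin 2) (i : ℕ) : Fin 2 :=
  if h : i < n then b ⟨⟨i, h⟩, fun t => leafBit b t.1⟩ else 0
termination_by i
decreasing_by exact t.2

lemma leafBit_eq (b : Node n → Fin 2) (i : Fin n) :
    leafBit b i = b ⟨i, fun t => leafBit b t.1⟩ := by
  rw [leafBit, dif_pos i.2]

/-- The node on the path to the leaf `x` at depth `i`. -/
def Node.ofLeaf (x : Fin n → Fin 2) (i : Fin n) : Node n := ⟨i, fun t => x ⟨t, t.2.trans i.2⟩⟩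

/-- The child `w1` of the node `w`. -/
def Node.child (w : Node n) : Node (n + 1) :=
  ⟨w.1.succ, Fin.snoc (α := fun _ => Fin 2) w.2 1⟩

lemma follow_iff (b : Node n → Fin 2) (v : Node (n + 1)) :
    (∀ j : Fin v.1, b (v.pre j) = v.2 j) ↔ ∀ j : Fin v.1, v.2 j = leafBit b j := by
  constructor
  · intro h j
    obtain ⟨j, hj⟩ := j
    induction j using Nat.strong_induction_on with
    | _ j ih =>
      have hj' : j < n := by omega
      rw [← h, leafBit_eq b ⟨j, hj'⟩]
      congr 1
      simp only [Node.pre]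
      congr 1
      funext t
      exact ih t.1 t.2 _
  · intro h j
    have hj' : j.val < n := by omega
    rw [h j, leafBit_eq b ⟨j, hj'⟩]
    congr 1
    simp only [Node.pre]
    congr 1
    funext t
    exact h _

/-- At most one node of a level is the reached child along a 1, so a parity of indicators suffices
to read bit `i` of the leaf. -/
lemma sum_follow (b : Node n → Fin 2) (i : Fin n) :
    ∑ w : Fin i → Fin 2, bit (∀ j : Fin (Node.child ⟨i, w⟩).1,
      b ((Node.child ⟨i, w⟩).pre j) = (Node.child ⟨i, w⟩).2 j) = leafBit b i := by
  have h : ∀ w : Fin i → Fin 2, (∀ j : Fin (Node.child ⟨i, w⟩).1,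
      b ((Node.child ⟨i, w⟩).pre j) = (Node.child ⟨i, w⟩).2 j) ↔
      (w = fun t => leafBit b t.1) ∧ leafBit b i = 1 := by
    intro w
    rw [follow_iff]
    change (∀ j : Fin (i.val + 1), Fin.snoc (α := fun _ => Fin 2) w 1 j = leafBit b j) ↔ _
    rw [Fin.forall_fin_succ', funext_iff]
    simp [eq_comm]
  simp only [bit_congr (h _)]
  rw [Fintype.sum_eq_single (fun t => leafBit b t.1)]
  · simp only [true_and, bit]
    split_ifs <;> omega
  · intro w hw
    simp [bit, hw]

/-- That `x` is the reached leaf only constrains the nodes on the path to `x`. This turns the state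
after writing the output into a product over nodes for fixed `x`, so that the nodes can be reset in
parallel. -/
lemma eq_leafBit_iff (b : Node n → Fin 2) (x : Fin n → Fin 2) :
    (∀ i : Fin n, x i = leafBit b i) ↔ ∀ i, b (Node.ofLeaf x i) = x i := by
  constructor
  · intro h i
    rw [h i, leafBit_eq, Node.ofLeaf]
    congr 2
    funext t
    exact h _
  · intro h i
    obtain ⟨i, hi⟩ := i
    induction i using Nat.strong_induction_on with
    | _ i ih =>
      rw [← h, leafBit_eq, Node.ofLeaf]
      congr 2
      funext t
      exact ih t.1 t.2 _

end Leaf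

end MFCircuit

namespace MFCircuit

/-! ### Effect of writing the output and of resetting the nodes. -/

section Stages

lemma prod_ite_congr_forall {J J' : Type} [Fintype J] [Fintype J'] {p : J → Prop} {q : J' → Prop}
    [DecidablePred p] [DecidablePred q] (h : (∀ j, p j) ↔ ∀ j, q j) :
    ∏ j, (if p j then (1 : ℂ) else 0) = ∏ j, if q j then 1 else 0 := by
  rw [ParityChecks.prod_ite_eq_ite_forall, ParityChecks.prod_ite_eq_ite_forall]
  exact if_congr h rfl rfl

lemma zeroState_eq_prod {ι : Type} [Fintype ι] (y : ι → Fin 2) :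
    zeroState y = ∏ i, if y i = 0 then (1 : ℂ) else 0 :=
  (ParityChecks.prod_ite_eq_ite_forall fun i => y i = 0).symm

variable {n e L : ℕ}

lemma workAmp_update (s : Node n → Reg n e L) (he : e ≤ n) (y : Reg n e L → Fin 2)
    (q : Reg n e L) (c : Fin 2) (hq : ∀ w, s w ≠ q) (hq' : ∀ k, .inr (.inr k) ≠ q) :
    workAmp s he (Function.update y q c) = workAmp s he y := by
  have h1 : ∀ w, Function.update y q c (s w) = y (s w) := fun w => Function.update_of_ne (hq w) _ _
  have h2 : ∀ v, IsPath s (Function.update y q c) v ↔ IsPath s y v := fun v => by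
    simp only [IsPath, h1]
  have h3 : ∀ k, Function.update y q c (.inr (.inr k)) = y (.inr (.inr k)) := fun k =>
    Function.update_of_ne (hq' k) _ _
  simp only [workAmp, countersAmp, misses, h1, bit_congr (h2 _), qCount, qTop, qPath, h3]
  rfl

lemma path_of_workAmp_ne_zero {s : Node n → Reg n e L} {he : e ≤ n} {y : Reg n e L → Fin 2}
    (h : workAmp s he y ≠ 0) (v : Node (n + 1)) : y (qPath v) = bit (IsPath s y v) := by
  by_contra hc
  exact Finset.prod_ne_zero_iff.1 (right_ne_zero_of_mul h) v (Finset.mem_univ _) (if_neg hc)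

/-- The bits of the output register. -/
def outBits (y : Reg n e L → Fin 2) : Fin n → Fin 2 := fun i => y (qOut i)

/-- The source that reads the bits at the nodes, and the one that reads the output register. -/
def nodeSource : Node n → Reg n e L := qNode
def outSource : Node n → Reg n e L := fun w => qOut w.1

lemma isSource_nodeSource : IsSource (nodeSource : Node n → Reg n e L) := fun w k => by
  simp [nodeSource, qNode]

lemma isSource_outSource : IsSource (outSource : Node n → Reg n e L) := fun w k => by
  simp [outSource, qOut]

/-- Each level has exactly one node on the path to `x`. -/
lemma prod_onPath (x : Fin n → Fin 2) (A : Node n → ℂ) :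
    ∏ w, (if w = Node.ofLeaf x w.1 then A w else 1) = ∏ i, A (Node.ofLeaf x i) := by
  rw [Fintype.prod_sigma]
  refine Finset.prod_congr rfl fun i _ => ?_
  rw [Fintype.prod_eq_single fun t : Fin i => x ⟨t, t.2.trans i.2⟩]
  · exact if_pos rfl
  · intro v hv
    refine if_neg fun h => hv ?_
    simpa [Node.ofLeaf] using h

/-- The node of depth at most `n` that corresponds to an inner node. -/
def Node.incl (w : Node n) : Node (n + 1) := ⟨w.1.castSucc, w.2⟩

lemma isPath_incl (y : Reg n e L → Fin 2) (w : Node n) :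
    IsPath outSource y w.incl ↔ w = Node.ofLeaf (outBits y) w.1 := by
  obtain ⟨i, w⟩ := w
  rw [Node.ofLeaf, Sigma.mk.injEq, heq_eq_eq, funext_iff]
  simp only [true_and]
  exact forall_congr' fun j => eq_comm

lemma isPath_child (y : Reg n e L → Fin 2) (w : Node n) :
    IsPath outSource y w.child ↔ w = Node.ofLeaf (outBits y) w.1 ∧ y (qOut w.1) = 1 := by
  rw [← isPath_incl]
  obtain ⟨i, w⟩ := w
  change (∀ j : Fin (i.val + 1), _ = Fin.snoc (α := fun _ => Fin 2) w 1 j) ↔ _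
  rw [Fin.forall_fin_succ']
  simp only [Fin.snoc_castSucc, Fin.snoc_last]
  exact Iff.rfl

lemma isPath_leaf (y : Reg n e L → Fin 2) (a : Fin n → Fin 2) :
    IsPath outSource y ⟨Fin.last n, a⟩ ↔ a = outBits y := by
  rw [funext_iff]
  exact forall_congr' fun j => eq_comm

/-- The phases that write the leaf into the output register. -/
noncomputable def outPhase (y : Reg n e L → Fin 2) : ℂ :=
  ∏ i : Fin n, bsign (y (qOut i)) (∑ w : Fin i → Fin 2, y (qPath (Node.child ⟨i, w⟩)))

/-- The amplitude `c` at the node `w`, where the path to the output has been fixed. -/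
def pathAmp (φ : Node n → Fin 2 → ℂ) (y : Reg n e L → Fin 2) (w : Node n) (c : Fin 2) : ℂ :=
  φ w c * if w = Node.ofLeaf (outBits y) w.1 then if c = y (qOut w.1) then 1 else 0 else 1

lemma write_out (he : e ≤ n) (φ : Node n → Fin 2 → ℂ) :
    conjDiag qOut (fun _ => hadamard) (fun _ => hadamard) outPhase
      (fun y : Reg n e L → Fin 2 => (∏ w, φ w (y (qNode w))) * workAmp nodeSource he y *
        ∏ i, if y (qOut i) = 0 then 1 else 0) =
      fun y => (∏ w, pathAmp φ y w (y (qNode w))) * workAmp nodeSource he y := by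
  rw [conjDiag_hadamard (qOut : _ → Reg n e L) qOut_injective
    (fun y => (∏ w, φ w (y (qNode w))) * workAmp nodeSource he y)
    (fun _ _ a => if a = 0 then 1 else 0)
    (fun i y => ∑ w : Fin i → Fin 2, y (qPath (Node.child ⟨i, w⟩))) outPhase
    (fun x j c => by
      rw [workAmp_update _ _ _ _ _ (by simp [nodeSource, qNode, qOut]) (by simp [qOut])]
      rfl) (fun _ _ _ _ => rfl) (fun _ _ _ _ => rfl) (fun x => rfl)]
  funext y
  by_cases h0 : workAmp nodeSource he y = 0
  · simp [h0]
  · have h1 : ∀ i : Fin n, ∑ w : Fin i → Fin 2, y (qPath (Node.child ⟨i, w⟩)) =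
        leafBit (fun w => y (qNode w)) i := by
      intro i
      rw [← sum_follow]
      exact Finset.sum_congr rfl fun w _ => path_of_workAmp_ne_zero h0 _
    have h2 : ∀ a b : Fin 2, a + b = 0 ↔ a = b := by
      intro a b
      omega
    simp only [h1, h2]
    rw [mul_right_comm]
    congr 1
    simp only [pathAmp]
    rw [Finset.prod_mul_distrib, prod_onPath (outBits y)
      fun w => if y (qNode w) = y (qOut w.1) then 1 else 0]
    congr 1
    exact prod_ite_congr_forall (eq_leafBit_iff (fun w => y (qNode w)) (outBits y))

/-- The phases that reset the bits at the nodes on the path. -/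
noncomputable def flipPhase (y : Reg n e L → Fin 2) : ℂ :=
  ∏ w, bsign (y (qNode w)) (y (qPath w.child))

/-- The phases of the amplitudes. -/
noncomputable def leafPhase (α : (Fin n → Fin 2) → ℝ) (y : Reg n e L → Fin 2) : ℂ :=
  ∏ a : Fin n → Fin 2, if y (qPath ⟨Fin.last n, a⟩) = 1 then Complex.exp (Complex.I * α a) else 1

/-- The phases that reset the bits at the nodes off the path. -/
noncomputable def reflectPhase (α : (Fin n → Fin 2) → ℝ) (y : Reg n e L → Fin 2) : ℂ :=
  leafPhase α y * ∏ w, bsign (y (qNode w)) (1 + y (qPath w.incl))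

/-- On the path the node bit equals the output bit, which is also the indicator of `w.child`, so the
flip clears it, and the sign is trivial. Off the path nothing is flipped and the sign switches on
the reflection of `rotation_reflect`. -/
lemma reset_node (t : Node n → ℝ) (y : Reg n e L → Fin 2) {he : e ≤ n}
    (h0 : workAmp outSource he y ≠ 0) (w : Node n) (a : Fin 2) :
    ∑ b, (rotation (t w)).1 a b * (bsign b (1 + y (qPath w.incl)) *
      ∑ c, (rotation (-t w)).1 b c * pathAmp (fun w c => (angleAmp (t w) c : ℂ)) y w
        (c + y (qPath w.child))) =
      (if a = 0 then 1 else 0) * if w = Node.ofLeaf (outBits y) w.1 then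
        (angleAmp (t w) (outBits y w.1) : ℂ) else 1 := by
  rw [path_of_workAmp_ne_zero h0, path_of_workAmp_ne_zero h0, bit_congr (isPath_child y w),
    bit_congr (isPath_incl y w)]
  by_cases hw : w = Node.ofLeaf (outBits y) w.1
  · have h1 : bit (w = Node.ofLeaf (outBits y) w.1 ∧ y (qOut w.1) = 1) = y (qOut w.1) := by
      rw [bit]
      split_ifs with h
      · exact h.2.symm
      · have : y (qOut w.1) ≠ 1 := fun h' => h ⟨hw, h'⟩
        omega
    have h2 : 1 + bit (w = Node.ofLeaf (outBits y) w.1) = 0 := by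
      rw [bit, if_pos hw]; rfl
    rw [h1, h2, rotation_neg, pathAmp, if_pos hw, if_pos hw]
    by_cases ha : a = 0
    · simp [ha, outBits]
    · simp [ha]
  · have h1 : bit (w = Node.ofLeaf (outBits y) w.1 ∧ y (qOut w.1) = 1) = 0 := if_neg fun h => hw h.1
    have h2 : 1 + bit (w = Node.ofLeaf (outBits y) w.1) = 1 := by
      rw [bit, if_neg hw]; rfl
    simp only [h1, h2, pathAmp, if_neg hw, mul_one, add_zero]
    exact rotation_reflect _ _

lemma leafPhase_eq (α : (Fin n → Fin 2) → ℝ) (y : Reg n e L → Fin 2) {he : e ≤ n}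
    (h0 : workAmp outSource he y ≠ 0) :
    leafPhase α y = Complex.exp (Complex.I * α (outBits y)) := by
  rw [leafPhase, Fintype.prod_eq_single (outBits y)]
  · rw [path_of_workAmp_ne_zero h0, if_pos (bit_eq_one.2 ((isPath_leaf y _).2 rfl))]
  · intro a ha
    rw [path_of_workAmp_ne_zero h0, if_neg]
    rw [bit_eq_one, isPath_leaf]
    exact ha

lemma reset_nodes (he : e ≤ n) (t : Node n → ℝ) (α : (Fin n → Fin 2) → ℝ) :
    conjDiag qNode (fun w => rotation (-t w)) (fun w => rotation (t w)) (reflectPhase α)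
      (conjDiag qNode (fun _ => hadamard) (fun _ => hadamard) flipPhase
        fun y : Reg n e L → Fin 2 => workAmp outSource he y *
          ∏ w, pathAmp (fun w c => (angleAmp (t w) c : ℂ)) y w (y (qNode w))) =
      fun y => ((∏ w, if y (qNode w) = 0 then 1 else 0) *
        (Complex.exp (Complex.I * α (outBits y)) *
          ∏ i, (angleAmp (t (Node.ofLeaf (outBits y) i)) (outBits y i) : ℂ))) *
            workAmp outSource he y := by
  have hu : ∀ (x : Reg n e L → Fin 2) j c,
      workAmp outSource he (Function.update x (qNode j) c) = workAmp outSource he x :=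
    fun x j c => workAmp_update _ _ _ _ _ (by simp [outSource, qNode, qOut]) (by simp [qNode])
  rw [conjDiag_hadamard (qNode : _ → Reg n e L) qNode_injective (workAmp outSource he)
    (fun w y => pathAmp (fun w c => (angleAmp (t w) c : ℂ)) y w)
    (fun w y => y (qPath w.child)) flipPhase hu (fun _ _ _ _ => rfl) (fun _ _ _ _ => rfl)
    (fun x => rfl)]
  have h := conjDiag_prod (qNode : _ → Reg n e L) qNode_injective (fun w => rotation (-t w))
    (fun w => rotation (t w)) (workAmp outSource he) (leafPhase α)
    (fun w y c => pathAmp (fun w c => (angleAmp (t w) c : ℂ)) y w (c + y (qPath w.child)))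
    (fun w y b => bsign b (1 + y (qPath w.incl))) (reflectPhase α) hu (fun _ _ _ => rfl)
    (fun _ _ _ _ => rfl) (fun _ _ _ _ => rfl) (fun x => rfl)
  refine h.trans ?_
  funext y
  by_cases h0 : workAmp outSource he y = 0
  · simp [h0]
  · simp only [reset_node t y h0, leafPhase_eq α y h0]
    rw [Finset.prod_mul_distrib, prod_onPath (outBits y)
      fun w => (angleAmp (t w) (outBits y w.1) : ℂ)]
    simp only [Node.ofLeaf]
    ring

lemma prepare_nodes (t : Node n → ℝ) :
    loc qNode (fun w => rotation (2 * t w)) (zeroState : QState (Reg n e L)) =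
      fun y => ((∏ w, (angleAmp (t w) (y (qNode w)) : ℂ)) * ∏ i, if y (qOut i) = 0 then 1 else 0) *
        zeroAmp y := by
  have h := locL_univ_prod (qNode : _ → Reg n e L) qNode_injective (fun w => rotation (2 * t w))
    (fun y => (∏ i, if y (qOut i) = 0 then 1 else 0) * zeroAmp y)
    (fun _ _ a => if a = 0 then 1 else 0) (fun _ _ _ => rfl) (fun _ _ _ _ => rfl)
  rw [loc]
  convert h using 1
  · congr 1
    funext y
    have hz : zeroState y = (∏ i, if y (qOut i) = 0 then (1 : ℂ) else 0) *
        ((∏ w, if y (qNode w) = 0 then 1 else 0) * ((∏ u, if y (qCount u) = 0 then 1 else 0) *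
          ((∏ u, if y (qTop u) = 0 then 1 else 0) * ∏ v, if y (qPath v) = 0 then 1 else 0))) := by
      rw [zeroState_eq_prod, Fintype.prod_sum_type, Fintype.prod_sum_type, Fintype.prod_sum_type,
        Fintype.prod_sum_type]
      rfl
    rw [hz, zeroAmp]
    ring
  · funext y
    simp only [mul_ite, mul_one, mul_zero, Finset.sum_ite_eq', Finset.mem_univ, if_true,
      rotation_two_mul]
    ring

end Stages
end MFCircuit

namespace MFCircuit

/-! ### Length of the phase products of these stages. -/

section StageCosts

variable {n e L : ℕ}

lemma hasPhase_bsign_bit {R : Type} [Nonempty R] (i j : R) (b : Fin 2) :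
    HasPhase 8 fun x => bsign (x i) (x j + b) := by
  convert hasPhase_bsign_and [(j, 1 + b)] i 8 (by simp) (p := fun x => x j = 1 + b) (by simp)
    using 3 with x
  rw [bit]
  split_ifs <;> omega

lemma card_node_le (m : ℕ) : Fintype.card (Node m) ≤ 2 ^ m := by
  have := card_node_add_one m
  omega

lemma hasPhase_outPhase : HasPhase (2 ^ n * 8) (outPhase : (Reg n e L → Fin 2) → ℂ) := by
  have h : (outPhase : (Reg n e L → Fin 2) → ℂ) = fun y => ∏ w : Node n,
      bsign (y (qOut w.1)) (y (qPath w.child) + 0) := by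
    funext y
    rw [outPhase, Fintype.prod_sigma]
    simp only [bsign_sum_right, add_zero]
  rw [h]
  refine (HasPhase.prod Finset.univ fun w _ => hasPhase_bsign_bit _ _ _).mono ?_
  exact Nat.mul_le_mul_right _ (by rw [Finset.card_univ]; exact card_node_le n)

lemma hasPhase_flipPhase : HasPhase (2 ^ n * 8) (flipPhase : (Reg n e L → Fin 2) → ℂ) := by
  have h : (flipPhase : (Reg n e L → Fin 2) → ℂ) = fun y => ∏ w : Node n,
      bsign (y (qNode w)) (y (qPath w.child) + 0) := by
    funext y
    simp only [flipPhase, add_zero]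
  rw [h]
  refine (HasPhase.prod Finset.univ fun w _ => hasPhase_bsign_bit _ _ _).mono ?_
  exact Nat.mul_le_mul_right _ (by rw [Finset.card_univ]; exact card_node_le n)

lemma hasPhase_reflectPhase (α : (Fin n → Fin 2) → ℝ) :
    HasPhase (2 ^ n * 10) (reflectPhase α : (Reg n e L → Fin 2) → ℂ) := by
  have h1 : HasPhase (2 ^ n * 2) (leafPhase α : (Reg n e L → Fin 2) → ℂ) := by
    refine (HasPhase.prod (N := 2) Finset.univ fun a _ => ?_).mono (by simp)
    convert hasPhase_and [(qPath ⟨Fin.last n, a⟩, 1)] (α a) using 2 with y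
    · simp
    · simp
  have h2 : HasPhase (2 ^ n * 8) fun y : Reg n e L → Fin 2 => ∏ w : Node n,
      bsign (y (qNode w)) (1 + y (qPath w.incl)) := by
    simp only [add_comm (1 : Fin 2)]
    refine (HasPhase.prod Finset.univ fun w _ => hasPhase_bsign_bit _ _ _).mono ?_
    exact Nat.mul_le_mul_right _ (by rw [Finset.card_univ]; exact card_node_le n)
  exact (h1.mul h2).mono (by omega)

end StageCosts

/-! ### Assembly of the stages. -/

section Main

variable {n e L : ℕ}

lemma exists_polar (ψ : EuclideanSpace ℂ (Fin n → Fin 2)) (hψ : ‖ψ‖ = 1) :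
    ∃ (t : Node n → ℝ) (α : (Fin n → Fin 2) → ℝ), ∀ x, ψ x = Complex.exp (Complex.I * α x) *
      ∏ i, (angleAmp (t (Node.ofLeaf x i)) (x i) : ℂ) := by
  obtain ⟨t, ht⟩ := exists_angles n (fun x => ‖ψ x‖) (fun x => norm_nonneg _) (by
    rw [← EuclideanSpace.norm_sq_eq, hψ, one_pow])
  refine ⟨fun w => t w.1 w.2, fun x => (ψ x).arg, fun x => ?_⟩
  have h := Complex.norm_mul_exp_arg_mul_I (ψ x)
  rw [ht x] at h
  rw [← h, mul_comm, mul_comm Complex.I]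
  push_cast
  rfl

/-- A simulated operator that maps `|0…0⟩` to `ψ ⊗ |0…0⟩`. -/
lemma exists_sim (ψ : EuclideanSpace ℂ (Fin n → Fin 2)) (hψ : ‖ψ‖ = 1) (he : e ≤ n)
    (hL : n < 2 ^ L) (N k : ℕ) (hk : n ≤ e + k)
    (h1 : 2 ^ (e + 1) * L * (n * 8) ≤ N) (h2 : 2 ^ (e + 1) * (2 ^ (L + 1) * (L + 1)) ≤ N)
    (h3 : 2 ^ (n + 1) * (2 ^ (k + 2) * (k + 2)) ≤ N) (h4 : 2 ^ n * 10 ≤ N) :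
    ∃ T : QState (Reg n e L) → QState (Reg n e L), Sim N 196 30 T ∧
      T zeroState = tensorZero ψ := by
  obtain ⟨t, α, hψt⟩ := exists_polar ψ hψ
  obtain ⟨hG, G', hG', hGs⟩ := revSim_computePaths (L := L) nodeSource he N k hk h1 h2 h3
  obtain ⟨hF, F', hF', hFs⟩ := revSim_computePaths (L := L) outSource he N k hk h1 h2 h3
  have hA := (revSim_conjDiag (qOut : _ → Reg n e L) qOut_injective (fun _ => hadamard)
    (fun _ => hadamard) (hasPhase_outPhase.mono (show 2 ^ n * 8 ≤ N by omega))).1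
  have hB := (revSim_conjDiag (qNode : _ → Reg n e L) qNode_injective (fun _ => hadamard)
    (fun _ => hadamard) (hasPhase_flipPhase.mono (show 2 ^ n * 8 ≤ N by omega))).1
  have hC := (revSim_conjDiag (qNode : _ → Reg n e L) qNode_injective (fun w => rotation (-t w))
    (fun w => rotation (t w)) ((hasPhase_reflectPhase α).mono h4)).1
  have hD := (revSim_loc N (qNode : _ → Reg n e L) qNode_injective
    fun w => rotation (2 * t w)).1
  refine ⟨_, hFs.comp (hC.comp (hB.comp (hF.comp (hGs.comp (hA.comp (hG.comp hD)))))), ?_⟩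
  simp only [Function.comp_apply]
  rw [prepare_nodes]
  have e1 := computePaths_apply (isSource_nodeSource (L := L)) he hL
    (fun y => (∏ w, (angleAmp (t w) (y (qNode w)) : ℂ)) * ∏ i, if y (qOut i) = 0 then 1 else 0)
    (fun _ _ _ => rfl)
  have e2 := write_out (L := L) he fun w c => (angleAmp (t w) c : ℂ)
  have e3 := computePaths_apply (isSource_nodeSource (L := L)) he hL
    (fun y => ∏ w, pathAmp (fun w c => (angleAmp (t w) c : ℂ)) y w (y (qNode w)))
    (fun _ _ _ => rfl)
  have e4 := computePaths_apply (isSource_outSource (L := L)) he hL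
    (fun y => ∏ w, pathAmp (fun w c => (angleAmp (t w) c : ℂ)) y w (y (qNode w)))
    (fun _ _ _ => rfl)
  have e5 := reset_nodes (L := L) he t α
  have e6 := computePaths_apply (isSource_outSource (L := L)) he hL
    (fun y => (∏ w, if y (qNode w) = 0 then 1 else 0) *
        (Complex.exp (Complex.I * α (outBits y)) *
          ∏ i, (angleAmp (t (Node.ofLeaf (outBits y) i)) (outBits y i) : ℂ)))
    (fun _ _ _ => rfl)
  rw [e1]
  simp only [mul_right_comm _ (∏ i : Fin n, _) (workAmp _ _ _)]
  -- By `e3` the state after writing the output is again of the form "indicators computed from the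
  -- nodes", so `G'` clears the workspace; `e4` refills it from the output.
  rw [e2, ← e3, hG', e4]
  simp only [mul_comm _ (workAmp _ _ _)]
  -- Resetting the nodes does not touch the output, from which the indicators now come, so `F'`
  -- still clears the workspace.
  rw [e5, ← e6, hF']
  funext y
  simp only [← hψt]
  have hz : (∏ w, if y (qNode w) = 0 then (1 : ℂ) else 0) * zeroAmp y =
      ∏ k : Node n ⊕ _, if y (.inr k) = 0 then (1 : ℂ) else 0 := by
    rw [Fintype.prod_sum_type, Fintype.prod_sum_type, Fintype.prod_sum_type, zeroAmp, mul_assoc]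
    rfl
  rw [mul_right_comm, hz, ParityChecks.prod_ite_eq_ite_forall, tensorZero]
  simp only [ite_mul, one_mul, zero_mul]
  rfl

end Main
end MFCircuit

theorem mainTheorem2 :
    ∃ D K : ℕ, ∀ (n : ℕ) (ψ : EuclideanSpace ℂ (Fin n → Fin 2)), ‖ψ‖ = 1 →
      ∃ (m : ℕ) (C : MFCircuit (Fin n ⊕ Fin m)),
        C.Prepares ψ ∧
        MFCircuit.depth C ≤ D ∧
        MFCircuit.size C ≤ K * (n * 2 ^ n) ∧
        m ≤ K * (n * 2 ^ n) ∧
        MFCircuit.measLayers C ≤ 81 := by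
  -- The depth is four indicator computations of depth 39, three phase stages of depth 13 and one
  -- layer of rotations. There are at most `139 * (n * 2 ^ n)` qubits, and `196 * 139 < 30000`.
  refine ⟨196, 30000, fun n ψ hψ => ?_⟩
  -- For `n = 0` the budget is zero, and `ψ` is a mere phase: the empty circuit works.
  rcases Nat.eq_zero_or_pos n with rfl | hn
  · refine ⟨0, [], fun r => ⟨(ψ default)⁻¹, ?_⟩, by simp [MFCircuit.depth],
      by simp [MFCircuit.size], by simp, by simp [MFCircuit.measLayers]⟩
    have h0 : ψ default ≠ 0 := by
      intro h0
      have : ψ = 0 := by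
        ext x
        rw [Subsingleton.elim x default, h0]
        rfl
      simp [this] at hψ
    funext y
    have hy : (fun i => y (Sum.inl i) : Fin 0 → Fin 2) = default := Subsingleton.elim _ _
    simp only [MFCircuit.branch, MFCircuit.zeroState, MFCircuit.withAncillas, Pi.smul_apply,
      smul_eq_mul, hy, IsEmpty.forall_iff, if_true]
    rw [inv_mul_cancel₀ h0]
  set L := Nat.log 2 n + 1 with hL
  -- This balances the two indicator stages: `2 ^ k * 2 ^ k ≤ 2 * n` keeps the conjunctions of `k +
  -- 2` literals within budget, while `L + 1 ≤ 2 * 2 ^ k` lets the saving `2 ^ e = 2 ^ n / 2 ^ k` in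
  -- the number of counted nodes pay for the counters.
  set k := L / 2 with hk
  set e := n - k with he
  have hL1 : n < 2 ^ L := Nat.lt_pow_succ_log_self (by norm_num) n
  have hL2 : 2 ^ L ≤ 2 * n := by
    rw [hL, pow_succ, mul_comm]
    exact Nat.mul_le_mul_left _ (Nat.pow_log_le_self 2 hn.ne')
  have hk1 : k + 1 ≤ 2 ^ k := Nat.lt_two_pow_self
  have hkn : k ≤ n := by
    have : L ≤ n + 1 := by
      have := Nat.log_lt_self 2 hn.ne'
      omega
    omega
  have hkk : 2 ^ k * 2 ^ k ≤ 2 ^ L := by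
    rw [← pow_add]
    exact Nat.pow_le_pow_right (by norm_num) (by omega)
  have hen : 2 ^ e * 2 ^ k = 2 ^ n := by
    rw [← pow_add]
    congr 1
    omega
  have hLk : L + 1 ≤ 2 * 2 ^ k := by omega
  set A := 2 ^ e
  set B := 2 ^ k
  have hA : 1 ≤ A := Nat.one_le_two_pow
  have h1 : 2 ^ (e + 1) * L * (n * 8) ≤ 32 * (n * 2 ^ n) := by
    rw [← hen, pow_succ]
    calc A * 2 * L * (n * 8) ≤ A * 2 * (2 * B) * (n * 8) := by gcongr; omega
      _ = 32 * (n * (A * B)) := by ring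
  have h2 : 2 ^ (e + 1) * (2 ^ (L + 1) * (L + 1)) ≤ 32 * (n * 2 ^ n) := by
    rw [← hen, pow_succ, pow_succ]
    calc A * 2 * (2 ^ L * 2 * (L + 1)) ≤ A * 2 * (2 * n * 2 * (2 * B)) := by gcongr
      _ ≤ 32 * (n * (A * B)) := by nlinarith [Nat.zero_le (n * (A * B))]
  have h3 : 2 ^ (n + 1) * (2 ^ (k + 2) * (k + 2)) ≤ 32 * (n * 2 ^ n) := by
    rw [pow_succ, pow_add]
    calc 2 ^ n * 2 * (B * 2 ^ 2 * (k + 2)) ≤ 2 ^ n * 2 * (B * 2 ^ 2 * (2 * B)) := by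
          gcongr; omega
      _ = 2 ^ n * 16 * (B * B) := by ring
      _ ≤ 2 ^ n * 16 * (2 * n) := Nat.mul_le_mul_left _ (hkk.trans hL2)
      _ = 32 * (n * 2 ^ n) := by ring
  have hnn : 2 ^ n ≤ n * 2 ^ n := Nat.le_mul_of_pos_left _ hn
  obtain ⟨T, hT, hT0⟩ := MFCircuit.exists_sim (e := e) ψ hψ (Nat.sub_le _ _) hL1
    (32 * (n * 2 ^ n)) k (by omega) h1 h2 h3 (by omega)
  obtain ⟨C, hC1, hC2, hC3⟩ := MFCircuit.exists_prepares ψ T hT 1 (by rw [hT0, one_smul])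
  have hcard : Fintype.card (MFCircuit.Node n ⊕ ((MFCircuit.Node (e + 1) × Fin L) ⊕
      (MFCircuit.Node (e + 1) ⊕ MFCircuit.Node (n + 1)))) ≤ 10 * (n * 2 ^ n) := by
    simp only [Fintype.card_sum, Fintype.card_prod, Fintype.card_fin]
    have c1 := MFCircuit.card_node_le n
    have c2 := MFCircuit.card_node_le (e + 1)
    have c3 := MFCircuit.card_node_le (n + 1)
    rw [pow_succ] at c2 c3
    have c4 : Fintype.card (MFCircuit.Node (e + 1)) * L ≤ 4 * 2 ^ n := by
      rw [← hen]
      calc _ ≤ A * 2 * (2 * B) := by gcongr; omega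
        _ = 4 * (A * B) := by ring
    have c5 : A ≤ 2 ^ n := Nat.pow_le_pow_right (by norm_num) (Nat.sub_le _ _)
    omega
  refine ⟨_, C, hC1, hC2, ?_, by omega, by omega⟩
  refine (MFCircuit.size_le C).trans ((Nat.mul_le_mul_right _ hC2).trans ?_)
  rw [Fintype.card_sum, Fintype.card_fin, Fintype.card_fin]
  have : n ≤ n * 2 ^ n := Nat.le_mul_of_pos_right _ (by positivity)
  omega
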